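/- Let $G$ be a GBS group, i.e. a group acting without inversions, minimally and cocompactly on a simplicial tree $T$ with all vertex and edge stabilizers infinite cyclic (call such a $G$-tree a GBS tree). Let $\mathcal D$ be the deformation space of $T$, i.e. the set of GBS trees for $G$ (endowed with arbitrary $G$-invariant positive edge lengths) having the same elliptic subgroups as $T$; here a subgroup is elliptic if it fixes a vertex, and an element is loxodromic if it fixes no vertex. Let $\Phi\in\mathrm{Out}(G)$, and let $\mathcal A$ be a set of subgroups of $G$ closed under conjugation and under passing to subgroups, and invariant under $\Phi$ (i.e. $\phi(H)\in\mathcal A\iff H\in\mathcal A$ for all $\phi\in\Phi$); for instance $\mathcal A$ may be the set of all subgroups. Let $\mathcal D^{\mathcal A}\subset\mathcal D$ be the set of trees whose edge stabilizers all lie in $\mathcal A$. A *special factor* is a subgroup of $G$ that is not elliptic in $\mathcal D$ and is the stabilizer of a vertex in a tree obtained from some $S\in\mathcal D^{\mathcal A}$ by collapsing the components of a $G$-invariant subforest; it is *proper* if it is not $G$. An element $h\in G$ is *simple* if it is loxodromic and contained in a proper special factor. An outer automorphism is *reducible* if it fixes the conjugacy class of some proper special factor. For a tree $S\in\mathcal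 D$, $\|g\|_S$ denotes the translation length of $g$ in $S$. The conjugacy class of $h$ is *pseudo-periodic* for $\Phi$ if for some $S\in\mathcal D$ and some $\phi\in\Phi$ the sequence $(\|\phi^n(h)\|_S)_{n\ge 0}$ is bounded. Let $h\in G$ be a simple element whose conjugacy class is pseudo-periodic for $\Phi$. Then there is $m\ge 1$ such that $\Phi^m$ is reducible. More precisely, there is a unique minimal special factor $A$ containing $h$ (it is contained in every special factor containing $h$), it is proper, and its conjugacy class is $\Phi$-periodic: there is $m\ge 1$ such that $\phi(A)$ is conjugate to $A$ for every $\phi\in\Phi^m$. -/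

import Mathlib

universe u

/-! ### Outer automorphisms -/

instance innerNormal (G : Type u) [Group G] : (MulAut.conj (G := G)).range.Normal where
  conj_mem := by
    rintro _ ⟨g, rfl⟩ φ
    refine ⟨φ g, ?_⟩
    ext x
    simp [MulAut.conj_apply]

/-- `Out(G) = Aut(G) / Inn(G)`. -/
abbrev OutAut (G : Type u) [Group G] : Type u := MulAut G ⧸ (MulAut.conj (G := G)).range

/-- The outer class of an automorphism; `φ ∈ Φ` is written `outClass φ = Φ`. -/
abbrev outClass {G : Type u} [Group G] (φ : MulAut G) : OutAut G := QuotientGroup.mk φ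

/-- The image `φ(H)` of a subgroup under an automorphism. -/
abbrev autImage {G : Type u} [Group G] (φ : MulAut G) (H : Subgroup G) : Subgroup G :=
  H.map φ.toMonoidHom

/-- The outer automorphism `Φ` fixes the conjugacy class of the subgroup `A`:
`φ(A)` is conjugate to `A` for every `φ ∈ Φ`. -/
def FixesConjClass {G : Type u} [Group G] (Φ : OutAut G) (A : Subgroup G) : Prop :=
  ∀ φ : MulAut G, outClass φ = Φ → ∃ g : G, autImage φ A = autImage (MulAut.conj g) A

/-- The conjugacy class of `A` is `Φ`-periodic. -/
def IsPeriodicConjClass {G : Type u} [Group G] (Φ : OutAut G) (A : Subgroup G) : Prop :=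
  ∃ m : ℕ, 1 ≤ m ∧ FixesConjClass (Φ ^ m) A

/-! ### Simplicial `G`-trees -/

/-- A simplicial tree with an action of `G` by automorphisms without inversions. -/
structure GTree (G : Type u) [Group G] where
  V : Type u
  [act : MulAction G V]
  graph : SimpleGraph V
  isTree : graph.IsTree
  adj_smul : ∀ (g : G) (v w : V), graph.Adj v w → graph.Adj (g • v) (g • w)
  no_inversion : ∀ (g : G) (v w : V), graph.Adj v w → ¬ (g • v = w ∧ g • w = v)

attribute [instance] GTree.act

namespace GTree

variable {G : Type u} [Group G]

/-- The stabilizer of a vertex. -/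
def vertexStab (T : GTree G) (v : T.V) : Subgroup G := MulAction.stabilizer G v

/-- The stabilizer of the edge between two adjacent vertices (there are no inversions). -/
def edgeStab (T : GTree G) (v w : T.V) : Subgroup G := T.vertexStab v ⊓ T.vertexStab w

/-- There are finitely many orbits of vertices and of (oriented) edges. -/
def IsCocompact (T : GTree G) : Prop :=
  (∃ s : Set T.V, s.Finite ∧ ∀ v : T.V, ∃ g : G, g • v ∈ s) ∧
  ∃ s : Set (T.V × T.V), s.Finite ∧
    ∀ v w : T.V, T.graph.Adj v w → ∃ g : G, (g • v, g • w) ∈ s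

/-- There is no proper `G`-invariant subtree. -/
def IsMinimal (T : GTree G) : Prop :=
  ∀ s : Set T.V, (∀ (g : G), ∀ v ∈ s, g • v ∈ s) → (T.graph.induce s).Connected → s = Set.univ

/-- A subgroup is elliptic if it fixes a vertex. -/
def IsElliptic (T : GTree G) (H : Subgroup G) : Prop := ∃ v : T.V, H ≤ T.vertexStab v

/-- An element is loxodromic if it fixes no vertex. -/
def IsLoxodromic (T : GTree G) (g : G) : Prop := ∀ v : T.V, g • v ≠ v

end GTree

/-- `H` is isomorphic to `ℤ`. -/
def IsInfiniteCyclic {G : Type u} [Group G] (H : Subgroup G) : Prop := IsCyclic H ∧ Infinite H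

namespace GTree

variable {G : Type u} [Group G]

/-- A GBS tree: a minimal cocompact `G`-tree all of whose vertex and edge stabilizers are
infinite cyclic. A group which has such a tree is a GBS group. -/
structure IsGBSTree (T : GTree G) : Prop where
  minimal : T.IsMinimal
  cocompact : T.IsCocompact
  vertex_cyclic : ∀ v : T.V, IsInfiniteCyclic (T.vertexStab v)
  edge_cyclic : ∀ v w : T.V, T.graph.Adj v w → IsInfiniteCyclic (T.edgeStab v w)

/-- The deformation space `𝓓` of `T`: the GBS trees with the same elliptic subgroups as `T`.
(Edge lengths are recorded separately, see `EdgeLength`.) -/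
def deformationSpace (T : GTree G) : Set (GTree G) :=
  {S | S.IsGBSTree ∧ ∀ H : Subgroup G, S.IsElliptic H ↔ T.IsElliptic H}

/-- The restricted deformation space `𝓓^𝓐`: the trees in `𝓓` with edge stabilizers in `𝓐`. -/
def restrictedSpace (T : GTree G) (𝓐 : Set (Subgroup G)) : Set (GTree G) :=
  {S | S ∈ T.deformationSpace ∧ ∀ v w : S.V, S.graph.Adj v w → S.edgeStab v w ∈ 𝓐}

/-- `c` is a collapse map of `G`-trees: a surjective equivariant map which sends every edge to an
edge or to a vertex, and whose fibres are subtrees. Thus `S'` is obtained from `S` by collapsing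
to a point every component of the invariant subforest consisting of the edges `vw` with
`c v = c w`. -/
structure IsCollapse (S S' : GTree G) (c : S.V → S'.V) : Prop where
  surjective : Function.Surjective c
  equivariant : ∀ (g : G) (v : S.V), c (g • v) = g • c v
  edge : ∀ v w : S.V, S.graph.Adj v w → c v = c w ∨ S'.graph.Adj (c v) (c w)
  fibre : ∀ x : S'.V, (S.graph.induce (c ⁻¹' {x})).Connected

/-- A special factor (with respect to `𝓓^𝓐`, where `𝓓` is the deformation space of `T`): a
subgroup, not elliptic in `𝓓`, which is a vertex stabilizer in a collapse of a tree in `𝓓^𝓐`. -/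
def IsSpecialFactor (T : GTree G) (𝓐 : Set (Subgroup G)) (A : Subgroup G) : Prop :=
  ¬ T.IsElliptic A ∧
  ∃ S ∈ T.restrictedSpace 𝓐, ∃ (S' : GTree G) (c : S.V → S'.V), IsCollapse S S' c ∧
    ∃ x : S'.V, A = S'.vertexStab x

/-- A simple element: a loxodromic element contained in a proper special factor. -/
def IsSimpleElement (T : GTree G) (𝓐 : Set (Subgroup G)) (h : G) : Prop :=
  T.IsLoxodromic h ∧ ∃ A : Subgroup G, T.IsSpecialFactor 𝓐 A ∧ A ≠ ⊤ ∧ h ∈ A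

/-- `Φ` is reducible if it fixes the conjugacy class of a proper special factor. -/
def IsReducible (T : GTree G) (𝓐 : Set (Subgroup G)) (Φ : OutAut G) : Prop :=
  ∃ A : Subgroup G, T.IsSpecialFactor 𝓐 A ∧ A ≠ ⊤ ∧ FixesConjClass Φ A

/-- A `G`-invariant assignment of positive lengths to the edges, making `T` a metric tree. -/
structure EdgeLength (T : GTree G) where
  len : T.V → T.V → ℝ
  symm : ∀ v w, len v w = len w v
  pos : ∀ v w, T.graph.Adj v w → 0 < len v w
  smul : ∀ (g : G) (v w : T.V), len (g • v) (g • w) = len v w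

/-- The distance between two vertices: the infimum of the lengths of the edge paths. -/
noncomputable def EdgeLength.dist {T : GTree G} (ℓ : T.EdgeLength) (v w : T.V) : ℝ :=
  ⨅ p : T.graph.Walk v w, (p.darts.map fun d => ℓ.len d.fst d.snd).sum

/-- The translation length `‖g‖_T`. As there are no inversions, the infimum over the points of
the tree is attained at a vertex. -/
noncomputable def EdgeLength.translationLength {T : GTree G} (ℓ : T.EdgeLength) (g : G) : ℝ :=
  ⨅ v : T.V, ℓ.dist v (g • v)

/-- The conjugacy class of `h` is pseudo-periodic for `Φ`: for some tree `S ∈ 𝓓` (with some edge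
lengths) and some `φ ∈ Φ`, the sequence `‖φⁿ(h)‖_S`, `n ≥ 0`, is bounded. -/
def IsPseudoPeriodic (T : GTree G) (Φ : OutAut G) (h : G) : Prop :=
  ∃ S ∈ T.deformationSpace, ∃ (ℓ : S.EdgeLength) (φ : MulAut G), outClass φ = Φ ∧
    ∃ C : ℝ, ∀ n : ℕ, ℓ.translationLength ((φ ^ n) h) ≤ C

end GTree

/-- A family of allowed edge groups for `Φ`: a set of subgroups closed under conjugation and under
passing to subgroups, and invariant under `Φ`. -/
structure IsEdgeFamily {G : Type u} [Group G] (Φ : OutAut G) (𝓐 : Set (Subgroup G)) : Prop where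
  conj : ∀ H ∈ 𝓐, ∀ g : G, autImage (MulAut.conj g) H ∈ 𝓐
  subgroup : ∀ H ∈ 𝓐, ∀ K : Subgroup G, K ≤ H → K ∈ 𝓐
  invariant : ∀ φ : MulAut G, outClass φ = Φ → ∀ H : Subgroup G, autImage φ H ∈ 𝓐 ↔ H ∈ 𝓐

/-! Special factors are exactly the non-elliptic stabilizers of blocks, a block being a subtree, in
a tree of `𝓓^𝓐`, whose translates are equal or disjoint. The proof finds a least special factor
containing `h` and then applies the pigeonhole principle to the elements `φⁿ(h)`.

Two special factors `A`, `B` containing `h` meet in a special factor (`exists_nested_blocks`):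
expand each vertex of the collapsed tree carrying `A` into a copy of a tree carrying `B`, and pass
to the minimal subtree. What remains is a stopping argument, and two invariants provide it. The
first is the dimension of the space of homomorphisms `B → ℝ` killing elliptic elements, which is the
Betti number of the quotient graph. Restriction to a smaller special factor `D` is onto, so it is an
isomorphism once the dimension is minimal (`exists_rigid_specialFactor`). If `Y` is a block for `D`,
every edge of `S/B` outside the image of `Y` then separates `S/B` and cuts off a branch. The second
is the index of the factor in vertex stabilizers. For a vertex `v`, the group `Stab(v) ∩ h Stab(v)
h⁻¹` fixes the path from `v` to `hv`, which meets every block whose stabilizer contains `h`. This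
group therefore lies in every special factor containing `h`, and the indices are bounded. Choose a
factor `C` with largest indices. Intersecting it with another factor leaves the indices unchanged. A
potential for the logarithmic modulus then shows that stabilizers do not grow away from the core
along branches, and so the intersection is `C` itself (`IsBlock.le_of_relIndex_le`).

For periodicity, automorphisms must permute special factors. Elliptic elements are commensurated,
and a proper special factor containing a loxodromic element forces commensurated elements to be
elliptic, so ellipticity is invariant under automorphisms. Bounded translation length and local
finiteness of the tree give `n < m` such that suitable conjugates of `φⁿ(h)` and `φᵐ(h)` agree at
one vertex, as do their inverses. Such elements lie in the same special factors, so the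
corresponding images of the least factor coincide. -/

open SimpleGraph

/-! ### Cuts, projections and potentials in trees -/

namespace SimpleGraph

variable {V W : Type*} {Γ : SimpleGraph V} {Δ : SimpleGraph W}

/-- A set of vertices which is nonempty and connected in `Γ`. -/
def IsSubtree (Γ : SimpleGraph V) (Y : Set V) : Prop :=
  Y.Nonempty ∧ ∀ a ∈ Y, ∀ b ∈ Y, ∃ p : Γ.Walk a b, ∀ x ∈ p.support, x ∈ Y

theorem isSubtree_iff {Y : Set V} : Γ.IsSubtree Y ↔ (Γ.induce Y).Connected := by
  constructor
  · rintro ⟨⟨y, hy⟩, h⟩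
    have : Nonempty Y := ⟨⟨y, hy⟩⟩
    refine ⟨fun a b => ?_⟩
    obtain ⟨p, hp⟩ := h a a.2 b b.2
    exact ⟨p.induce Y hp⟩
  · intro h
    obtain ⟨⟨y, hy⟩⟩ := h.nonempty
    refine ⟨⟨y, hy⟩, fun a ha b hb => ?_⟩
    obtain ⟨p⟩ := h.preconnected ⟨a, ha⟩ ⟨b, hb⟩
    refine ⟨p.map (Embedding.induce Y).toHom, fun x hx => ?_⟩
    have hx' : x ∈ (p.map (Embedding.induce Y).toHom).support := hx
    rw [Walk.support_map, List.mem_map] at hx'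
    obtain ⟨z, -, rfl⟩ := hx'
    exact z.2

theorem Connected.isSubtree_univ (h : Γ.Connected) : Γ.IsSubtree Set.univ :=
  ⟨let ⟨v⟩ := h.nonempty; ⟨v, trivial⟩, fun a _ b _ => ⟨(h.preconnected a b).some, by simp⟩⟩

/-- A walk from inside to outside of `R` crosses the boundary of `R`. -/
theorem Walk.exists_crossing {a b : V} (p : Γ.Walk a b) (R : Set V) (ha : a ∈ R) (hb : b ∉ R) :
    ∃ c d, Γ.Adj c d ∧ c ∈ R ∧ d ∉ R ∧ c ∈ p.support ∧ d ∈ p.support := by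
  obtain ⟨d, hd, h1, h2⟩ := p.exists_boundary_dart R ha hb
  exact ⟨d.fst, d.snd, d.adj, h1, h2, p.dart_fst_mem_support_of_mem_darts hd,
    p.dart_snd_mem_support_of_mem_darts hd⟩

theorem IsSubtree.subset_of_closed {Y R : Set V} (hY : Γ.IsSubtree Y) {a : V} (ha : a ∈ Y)
    (haR : a ∈ R) (h : ∀ x ∈ Y, ∀ y ∈ Y, Γ.Adj x y → x ∈ R → y ∈ R) : Y ⊆ R := by
  intro b hb
  by_contra hbR
  obtain ⟨p, hp⟩ := hY.2 a ha b hb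
  obtain ⟨c, d, hcd, hc, hd, hcp, hdp⟩ := p.exists_crossing R haR hbR
  exact hd (h c (hp c hcp) d (hp d hdp) hcd hc)

/-- A function on a connected set which is constant along edges is constant. -/
theorem IsSubtree.constant {Y : Set V} (hY : Γ.IsSubtree Y) {β : Type*} (f : V → β)
    (h : ∀ x ∈ Y, ∀ y ∈ Y, Γ.Adj x y → f x = f y) {a b : V} (ha : a ∈ Y) (hb : b ∈ Y) :
    f a = f b :=
  (hY.subset_of_closed (R := {y | f a = f y}) ha rfl
    (fun x hx y hy hxy (hR : f a = f x) => hR.trans (h x hx y hy hxy)) hb)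

/-- In a forest, every edge `xz` is the only edge leaving some set of vertices. -/
theorem IsAcyclic.exists_cut (h : Γ.IsAcyclic) {x z : V} (hxz : Γ.Adj x z) :
    ∃ R : Set V, z ∈ R ∧ x ∉ R ∧ ∀ a b, Γ.Adj a b → a ∈ R → b ∉ R → a = z ∧ b = x := by
  have hb := isBridge_iff.1 (isAcyclic_iff_forall_adj_isBridge.1 h hxz)
  refine ⟨{y | (Γ.deleteEdges {s(x, z)}).Reachable z y}, Reachable.refl _,
    fun hx => hb hx.symm, fun a b hab ha hnb => ?_⟩
  by_contra hne
  apply hnb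
  refine Reachable.trans ha (Adj.reachable ?_)
  rw [deleteEdges_adj]
  refine ⟨hab, fun hmem => ?_⟩
  rw [Set.mem_singleton_iff, Sym2.eq_iff] at hmem
  rcases hmem with ⟨rfl, rfl⟩ | ⟨rfl, rfl⟩
  · exact hb ha.symm
  · exact hne ⟨rfl, rfl⟩

/-- A set with a single boundary edge makes that edge a bridge. Cuts, unlike cycles, are easy to
transport to quotients and glued graphs. -/
theorem isAcyclic_of_cuts (h : ∀ x z, Γ.Adj x z →
    ∃ R : Set V, z ∈ R ∧ x ∉ R ∧ ∀ a b, Γ.Adj a b → a ∈ R → b ∉ R → a = z ∧ b = x) :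
    Γ.IsAcyclic := by
  rw [isAcyclic_iff_forall_adj_isBridge]
  intro x z hxz
  rw [isBridge_iff]
  rintro ⟨p⟩
  obtain ⟨R, hz, hx, hR⟩ := h x z hxz
  obtain ⟨c, d, hcd, hc, hd, -, -⟩ := p.reverse.exists_crossing R hz hx
  rw [deleteEdges_adj] at hcd
  obtain ⟨rfl, rfl⟩ := hR c d hcd.1 hc hd
  exact hcd.2 Sym2.eq_swap

/-- A map sending edges to edges or vertices maps walks to walks. -/
theorem Walk.exists_lazy_map (f : V → W) (hf : ∀ a b, Γ.Adj a b → f a = f b ∨ Δ.Adj (f a) (f b))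
    {a b : V} (p : Γ.Walk a b) :
    ∃ q : Δ.Walk (f a) (f b), ∀ x ∈ q.support, ∃ y ∈ p.support, f y = x := by
  induction p with
  | nil => exact ⟨Walk.nil, by simp⟩
  | @cons a c b hac p ih =>
    obtain ⟨q, hq⟩ := ih
    rcases hf a c hac with h | h
    · refine ⟨q.copy h.symm rfl, fun x hx => ?_⟩
      rw [Walk.support_copy] at hx
      obtain ⟨y, hy, rfl⟩ := hq x hx
      exact ⟨y, by simp [hy], rfl⟩
    · refine ⟨Walk.cons h q, fun x hx => ?_⟩
      rw [Walk.support_cons, List.mem_cons] at hx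
      rcases hx with rfl | hx
      · exact ⟨a, by simp, rfl⟩
      · obtain ⟨y, hy, rfl⟩ := hq x hx
        exact ⟨y, by simp [hy], rfl⟩

theorem Walk.exists_first_hit (Y : Set V) {a b : V} (p : Γ.Walk a b) (ha : a ∉ Y) (hb : b ∈ Y) :
    ∃ u π, Γ.Adj u π ∧ π ∈ Y ∧ ∃ q : Γ.Walk a u, ∀ x ∈ q.support, x ∉ Y := by
  induction p with
  | nil => exact absurd hb ha
  | @cons a c b hac p ih =>
    by_cases hc : c ∈ Y
    · exact ⟨a, c, hac, hc, Walk.nil, by simpa using ha⟩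
    · obtain ⟨u, π, h1, h2, q, hq⟩ := ih hc hb
      refine ⟨u, π, h1, h2, Walk.cons hac q, fun x hx => ?_⟩
      rw [Walk.support_cons, List.mem_cons] at hx
      rcases hx with rfl | hx
      · exact ha
      · exact hq x hx

/-- Every vertex `w` has a projection to a subtree. -/
theorem IsTree.exists_gate (hΓ : Γ.IsTree) {Y : Set V} (hY : Γ.IsSubtree Y) (w : V) :
    ∃ π ∈ Y, (∀ y ∈ Y, ∀ p : Γ.Walk w y, π ∈ p.support) ∧
      ∃ p : Γ.Walk w π, ∀ x ∈ p.support, x ∈ Y → x = π := by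
  by_cases hw : w ∈ Y
  · exact ⟨w, hw, fun y _ p => p.start_mem_support, Walk.nil, by simp⟩
  obtain ⟨y₀, hy₀⟩ := hY.1
  obtain ⟨u, π, hu, hπ, q, hq⟩ :=
    (hΓ.connected.preconnected w y₀).some.exists_first_hit Y hw hy₀
  refine ⟨π, hπ, fun y hy p => ?_, q.concat hu, fun x hx hxY => ?_⟩
  -- The first edge entering `Y` separates `w` from all of `Y`, so every walk from `w` to `Y` uses
  -- it.
  · obtain ⟨R, hz, hx, hR⟩ := hΓ.isAcyclic.exists_cut hu
    have huY : u ∉ Y := hq u q.end_mem_support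
    have hYR : Y ⊆ R := hY.subset_of_closed hπ hz fun a _ b hb hab ha => by
      by_contra hbR
      obtain ⟨-, rfl⟩ := hR a b hab ha hbR
      exact huY hb
    have hwR : w ∉ R := fun hwR => by
      obtain ⟨c, d, hcd, hc, hd, hcp, -⟩ := q.exists_crossing R hwR hx
      obtain ⟨rfl, -⟩ := hR c d hcd hc hd
      exact hq c hcp hπ
    obtain ⟨c, d, hcd, hc, hd, hcp, -⟩ := p.reverse.exists_crossing R (hYR hy) hwR
    obtain ⟨rfl, -⟩ := hR c d hcd hc hd
    simpa using hcp
  · rw [Walk.support_concat, List.mem_append, List.mem_singleton] at hx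
    rcases hx with hx | hx
    · exact absurd hxY (hq x hx)
    · exact hx

/-- An antisymmetric function on the edges of a tree is the differential of a function. -/
theorem IsTree.exists_potential (hΓ : Γ.IsTree) (c : V → V → ℝ)
    (hc : ∀ x y, Γ.Adj x y → c y x = - c x y) :
    ∃ p : V → ℝ, ∀ x y, Γ.Adj x y → p y - p x = c x y := by
  classical
  obtain ⟨r⟩ := hΓ.connected.nonempty
  choose q hq using fun v => (hΓ.existsUnique_path r v).exists
  let S : ∀ {a b : V}, Γ.Walk a b → ℝ := fun p => (p.darts.map fun d => c d.fst d.snd).sum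
  have key : ∀ x y, Γ.Adj x y → x ∈ (q y).support → S (q y) - S (q x) = c x y := by
    intro x y hxy hx
    have := hΓ.isAcyclic.path_concat (hq x) (hq y) hxy hx
    rw [this]
    simp [S, Walk.darts_concat]
  refine ⟨fun v => S (q v), fun x y hxy => ?_⟩
  by_cases hx : x ∈ (q y).support
  · exact key x y hxy hx
  · have := key y x hxy.symm
      (hΓ.isAcyclic.mem_support_of_ne_mem_support_of_adj_of_isPath (hq x) (hq y) hxy hx)
    rw [hc x y hxy] at this
    dsimp only
    linarith

/-- An injective endomorphism of a tree fixing two vertices fixes the path between them. -/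
theorem IsTree.exists_fixed_path (hΓ : Γ.IsTree) {x y : V} :
    ∃ p : Γ.Walk x y, p.IsPath ∧ ∀ f : Γ →g Γ, Function.Injective f → f x = x → f y = y →
      ∀ z ∈ p.support, f z = z := by
  obtain ⟨p, hp, hu⟩ := hΓ.existsUnique_path x y
  refine ⟨p, hp, fun f hf hx hy z hz => ?_⟩
  have h1 := hu ((p.map f).copy hx hy) (by
    simpa using hp.map hf)
  have h2 : p.support.map f = p.support := by
    have := congrArg Walk.support h1
    simpa using this
  have h3 : ∀ l : List V, l.map f = l → ∀ z ∈ l, f z = z := by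
    intro l
    induction l with
    | nil => simp
    | cons a l ih =>
      intro h z hz
      rw [List.map_cons, List.cons.injEq] at h
      rcases List.mem_cons.1 hz with rfl | hz
      · exact h.1
      · exact ih h.2 z hz
  exact h3 _ h2 z hz

/-- In a forest a walk is a path as soon as consecutive edges differ, so only the junctions matter.
All of them are images of the junction of `p` with `f p`; the first edge is recorded to keep the
induction going. -/
theorem IsAcyclic.exists_iterate_path (hΓ : Γ.IsAcyclic) (f : Γ →g Γ) (hf : Function.Injective f)
    {v : V} (p : Γ.Walk v (f v)) (hp : (p.append (p.map f)).IsPath) (n : ℕ) :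
    ∃ q : Γ.Walk v (f^[n + 1] v), q.IsPath ∧ q.length = (n + 1) * p.length ∧
      q.edges.head? = p.edges.head? := by
  induction n with
  | zero => exact ⟨p, hp.of_append_left, by simp, rfl⟩
  | succ n ih =>
    obtain ⟨q, hq, hl, hh⟩ := ih
    have h : f (f^[n + 1] v) = f^[n + 1 + 1] v := (Function.iterate_succ_apply' f (n + 1) v).symm
    rw [hΓ.isPath_iff_isChain, Walk.edges_append, List.isChain_append] at hp
    refine ⟨(p.append (q.map f)).copy rfl h, ?_, ?_, ?_⟩
    · rw [Walk.isPath_copy, hΓ.isPath_iff_isChain, Walk.edges_append, List.isChain_append]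
      refine ⟨hp.1, (hΓ.isPath_iff_isChain _).1 (hq.map hf), ?_⟩
      have : (q.map f).edges.head? = (p.map f).edges.head? := by
        rw [Walk.edges_map, Walk.edges_map, List.head?_map, List.head?_map, hh]
      rw [this]
      exact hp.2.2
    · rw [Walk.length_copy, Walk.length_append, Walk.length_map, hl]; ring
    · rw [Walk.edges_copy, Walk.edges_append, List.head?_append, Walk.edges_map, List.head?_map, hh]
      cases p.edges.head? <;> rfl

theorem IsTree.dist_eq_length (hΓ : Γ.IsTree) {x y : V} {p : Γ.Walk x y} (hp : p.IsPath) :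
    Γ.dist x y = p.length := by
  obtain ⟨q, hq, hl⟩ := hΓ.connected.exists_path_of_dist x y
  rw [(hΓ.existsUnique_path x y).unique hp hq, hl]

end SimpleGraph

namespace SimpleGraph

variable {V : Type*} {Γ : SimpleGraph V}

theorem IsSubtree.path_subset (hΓ : Γ.IsTree) {Y : Set V} (hY : Γ.IsSubtree Y) {a b : V}
    (ha : a ∈ Y) (hb : b ∈ Y) {p : Γ.Walk a b} (hp : p.IsPath) : ∀ x ∈ p.support, x ∈ Y := by
  classical
  obtain ⟨q, hq⟩ := hY.2 a ha b hb
  intro x hx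
  rw [(hΓ.existsUnique_path a b).unique hp q.bypass_isPath] at hx
  exact hq x (q.support_bypass_subset_support hx)

theorem IsSubtree.inter (hΓ : Γ.IsTree) {Y Z : Set V} (hY : Γ.IsSubtree Y) (hZ : Γ.IsSubtree Z)
    (h : (Y ∩ Z).Nonempty) : Γ.IsSubtree (Y ∩ Z) := by
  refine ⟨h, fun a ha b hb => ?_⟩
  obtain ⟨p, hp, -⟩ := hΓ.existsUnique_path a b
  exact ⟨p, fun x hx => ⟨hY.path_subset hΓ ha.1 hb.1 hp x hx, hZ.path_subset hΓ ha.2 hb.2 hp x hx⟩⟩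

theorem Walk.exists_ends {a b : V} (p : Γ.Walk a b) (hab : a ≠ b) :
    ∃ x y, Γ.Adj a x ∧ Γ.Adj y b ∧ p.edges.head? = some s(a, x) ∧
      p.edges.getLast? = some s(y, b) ∧ ((y = a ∧ x = b) ∨ Γ.dist x y + 2 ≤ p.length) := by
  cases p with
  | nil => exact absurd rfl hab
  | @cons _ x _ hax p =>
    cases p with
    | nil => exact ⟨b, a, hax, hax, by simp, by simp, Or.inl ⟨rfl, rfl⟩⟩
    | @cons _ c _ hxc p =>
      obtain ⟨y, q, hyb, hq⟩ := Walk.exists_cons_eq_concat hxc p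
      refine ⟨x, y, hax, hyb, by simp, ?_, Or.inr ?_⟩
      · rw [hq, Walk.edges_cons, Walk.edges_concat, List.concat_eq_append, ← List.cons_append,
          List.getLast?_concat]
      · rw [hq, Walk.length_cons, Walk.length_concat]
        have := dist_le q
        omega

end SimpleGraph

/-! ### Equivariant choices -/

theorem exists_orbit_representatives (G X : Type*) [Group G] [MulAction G X] :
    ∃ (r : X → X) (σ : X → G), (∀ (g : G) x, r (g • x) = r x) ∧ ∀ x, σ x • r x = x := by
  have h : ∀ x : X, ∃ g : G, g • (Quotient.mk (MulAction.orbitRel G X) x).out = x := fun x =>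
    MulAction.mem_orbit_iff.1 (MulAction.orbitRel_apply.1
      (Setoid.symm' _ (Quotient.mk_out (s := MulAction.orbitRel G X) x)))
  choose σ hσ using h
  refine ⟨fun x => (Quotient.mk (MulAction.orbitRel G X) x).out, σ, fun g x => ?_, hσ⟩
  have : Quotient.mk (MulAction.orbitRel G X) (g • x) = Quotient.mk _ x :=
    Quotient.sound (s := MulAction.orbitRel G X) (MulAction.mem_orbit x g)
  simp only [this]

/-- A choice of elements `σ x` carrying orbit representatives to `x`. -/
theorem exists_orbit_section (G X : Type*) [Group G] [MulAction G X] :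
    ∃ (r : X → X) (σ : X → G), (∀ x, σ x • r x = x) ∧ (∀ (g : G) x, r (g • x) = r x) ∧
      ∀ (g : G) (x : X), ((σ (g • x))⁻¹ * (g * σ x)) • r x = r x := by
  obtain ⟨r, σ, hrg, hσ⟩ := exists_orbit_representatives G X
  refine ⟨r, σ, hσ, hrg, fun g x => ?_⟩
  have h1 := hσ (g • x)
  rw [hrg] at h1
  rw [mul_smul, mul_smul, hσ x, inv_smul_eq_iff, h1]

/-- If stabilizers of points of the invariant set `s` fix points of `V` then there is an
equivariant map from `s` to `V`. -/
theorem exists_equivariantOn {G X V : Type*} [Group G] [MulAction G X] [MulAction G V] [Nonempty V]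
    (s : Set X) (hs : ∀ (g : G), ∀ x ∈ s, g • x ∈ s)
    (h : ∀ x ∈ s, ∃ v : V, ∀ g : G, g • x = x → g • v = v) :
    ∃ f : X → V, ∀ (g : G), ∀ x ∈ s, f (g • x) = g • f x := by
  obtain ⟨r, σ, hσ, hrg, h1⟩ := exists_orbit_section G X
  have h' : ∀ x, ∃ v : V, x ∈ s → ∀ g : G, g • x = x → g • v = v := fun x => by
    by_cases hx : x ∈ s
    · obtain ⟨v, hv⟩ := h x hx
      exact ⟨v, fun _ => hv⟩
    · exact ⟨Classical.arbitrary V, fun hx' => absurd hx' hx⟩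
  choose b hb using h'
  refine ⟨fun x => σ x • b (r x), fun g x hx => ?_⟩
  have hrx : r x ∈ s := by
    have := hs (σ x)⁻¹ x hx
    rwa [← eq_inv_smul_iff.2 (hσ x)] at this
  have key := hb _ hrx _ (h1 g x)
  rw [mul_smul, inv_smul_eq_iff, mul_smul] at key
  dsimp only
  rw [hrg, key]

/-! ### Elliptic and loxodromic elements -/

namespace GTree

variable {G : Type u} [Group G]

/-- The automorphism of the tree given by a group element. -/
def smulHom (T : GTree G) (g : G) : T.graph →g T.graph where
  toFun v := g • v
  map_rel' h := T.adj_smul g _ _ h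

theorem smulHom_injective (T : GTree G) (g : G) : Function.Injective (T.smulHom g) :=
  MulAction.injective g

theorem mem_vertexStab {T : GTree G} {v : T.V} {g : G} : g ∈ T.vertexStab v ↔ g • v = v := Iff.rfl

theorem mem_edgeStab {T : GTree G} {v w : T.V} {g : G} :
    g ∈ T.edgeStab v w ↔ g • v = v ∧ g • w = w := Iff.rfl

theorem exists_smul_walk (T : GTree G) (g : G) {a b : T.V} (p : T.graph.Walk a b) :
    ∃ q : T.graph.Walk (g • a) (g • b), q.length = p.length ∧
      ∀ x ∈ q.support, ∃ y ∈ p.support, g • y = x := by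
  refine ⟨p.map (T.smulHom g), Walk.length_map _ p, fun x hx => ?_⟩
  have hx' : x ∈ (p.map (T.smulHom g)).support := hx
  rw [Walk.support_map, List.mem_map] at hx'
  exact hx'

theorem dist_smul (T : GTree G) (g : G) (a b : T.V) :
    T.graph.dist (g • a) (g • b) = T.graph.dist a b := by
  have h : ∀ (g : G) (a b : T.V), T.graph.dist (g • a) (g • b) ≤ T.graph.dist a b := by
    intro g a b
    obtain ⟨p, hp⟩ := T.isTree.connected.exists_walk_length_eq_dist a b
    obtain ⟨q, hq, -⟩ := T.exists_smul_walk g p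
    rw [← hp, ← hq]
    exact dist_le q
  refine le_antisymm (h g a b) ?_
  simpa using h g⁻¹ (g • a) (g • b)

theorem exists_fixed_walk (T : GTree G) (x y : T.V) :
    ∃ p : T.graph.Walk x y, p.IsPath ∧ ∀ g : G, g • x = x → g • y = y →
      ∀ z ∈ p.support, g • z = z := by
  obtain ⟨p, hp, h⟩ := T.isTree.exists_fixed_path (x := x) (y := y)
  exact ⟨p, hp, fun g hx hy => h (T.smulHom g) (T.smulHom_injective g) hx hy⟩

/-- An elliptic subgroup preserving a subtree fixes a vertex of it. -/
theorem exists_fixed_mem (T : GTree G) {Y : Set T.V} (hY : T.graph.IsSubtree Y) {H : Subgroup G}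
    (hinv : ∀ g ∈ H, ∀ y ∈ Y, g • y ∈ Y) (hH : T.IsElliptic H) :
    ∃ y ∈ Y, H ≤ T.vertexStab y := by
  obtain ⟨v, hv⟩ := hH
  obtain ⟨π, hπ, h1, p, hp⟩ := T.isTree.exists_gate hY v
  refine ⟨π, hπ, fun g hg => ?_⟩
  obtain ⟨q, -, hq⟩ := T.exists_smul_walk g p
  have hgv : g • v = v := hv hg
  obtain ⟨z, hz, hzπ⟩ := hq π (by
    have := h1 (g • π) (hinv g hg π hπ) (q.copy hgv rfl)
    rwa [Walk.support_copy] at this)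
  have : z ∈ Y := by
    rw [eq_inv_smul_iff.2 hzπ]
    exact hinv _ (H.inv_mem hg) _ hπ
  have hzz := hp z hz this
  rw [hzz] at hzπ
  exact hzπ

/-- The paths from `w` to `x • w` meet any subtree preserved by the loxodromic element `x`. -/
theorem exists_mem_all_walks (T : GTree G) {Y : Set T.V} (hY : T.graph.IsSubtree Y) {x : G}
    (hx : T.IsLoxodromic x) (hinv : ∀ y, x • y ∈ Y ↔ y ∈ Y) (w : T.V) :
    ∃ π ∈ Y, ∀ p : T.graph.Walk w (x • w), π ∈ p.support := by
  obtain ⟨π, hπ, h1, r, hr⟩ := T.isTree.exists_gate hY w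
  refine ⟨π, hπ, fun p => ?_⟩
  by_contra hp
  obtain ⟨q, -, hq⟩ := T.exists_smul_walk x r
  -- The walk `p` followed by the translate of `r` ends in `Y`, so it contains the gate `π`. If `p`
  -- misses `π`, the translate of `r` contains it; but that translate meets `Y` only at `x • π`, and
  -- `x` would fix `π`.
  have h2 := h1 (x • π) ((hinv π).2 hπ) (p.append q)
  rw [Walk.mem_support_append_iff] at h2
  obtain ⟨z, hz, hzπ⟩ := hq π (h2.resolve_left hp)
  have hzz := hr z hz ((hinv z).1 (hzπ ▸ hπ))
  exact hx π (by rw [hzz] at hzπ; exact hzπ)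

theorem inter_nonempty_of_loxodromic (T : GTree G) {Y Z : Set T.V} (hY : T.graph.IsSubtree Y)
    (hZ : T.graph.IsSubtree Z) {x : G} (hx : T.IsLoxodromic x) (hxY : ∀ y, x • y ∈ Y ↔ y ∈ Y)
    (hxZ : ∀ y, x • y ∈ Z ↔ y ∈ Z) : (Y ∩ Z).Nonempty := by
  obtain ⟨w, hw⟩ := hZ.1
  obtain ⟨π, hπ, h⟩ := T.exists_mem_all_walks hY hx hxY w
  obtain ⟨p, hp⟩ := hZ.2 w hw (x • w) ((hxZ w).2 hw)
  exact ⟨π, hπ, hp π (h p)⟩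

/-- A loxodromic element translates along an axis. -/
theorem exists_translation (T : GTree G) {g : G} (hg : T.IsLoxodromic g) :
    ∃ (v : T.V) (l : ℕ), 1 ≤ l ∧ ∀ n : ℕ, T.graph.dist v (g ^ n • v) = n * l := by
  obtain ⟨v, hv⟩ : ∃ v : T.V, ∀ u, T.graph.dist v (g • v) ≤ T.graph.dist u (g • u) := by
    have := T.isTree.connected.nonempty
    obtain ⟨v, hv⟩ := Nat.sInf_mem (Set.range_nonempty fun v : T.V => T.graph.dist v (g • v))
    exact ⟨v, fun u => by
      have := Nat.sInf_le (Set.mem_range_self (f := fun v : T.V => T.graph.dist v (g • v)) u)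
      rw [← hv] at this
      exact this⟩
  obtain ⟨p, hp, hpl⟩ := T.isTree.connected.exists_path_of_dist v (T.smulHom g v)
  have hpos : 1 ≤ p.length := by
    rw [hpl]
    exact T.isTree.connected.pos_dist_of_ne (hg v).symm
  have hpath : (p.append (p.map (T.smulHom g))).IsPath := by
    -- A backtrack at `g • v` would give `y = g • x`. Then either `p` is a single edge inverted by
    -- `g`, or `x` is displaced by two less than the minimum.
    rw [T.isTree.isAcyclic.isPath_iff_isChain, Walk.edges_append, List.isChain_append]
    refine ⟨(T.isTree.isAcyclic.isPath_iff_isChain p).1 hp,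
      (T.isTree.isAcyclic.isPath_iff_isChain _).1 (hp.map (T.smulHom_injective g)), ?_⟩
    obtain ⟨x, y, hvx, hyb, hh, hl, hxy⟩ := p.exists_ends (hg v).symm
    intro e he e' he' hee
    rw [Walk.edges_map, List.head?_map, hh] at he'
    rw [hl, Option.mem_some_iff] at he
    rw [Option.map_some, Option.mem_some_iff] at he'
    rw [← he, ← he', Sym2.map_mk] at hee
    have hygx : y = g • x := by
      rcases Sym2.eq_iff.1 hee with ⟨h, -⟩ | ⟨h, -⟩
      · exact absurd h hyb.ne
      · exact h
    rcases hxy with ⟨rfl, rfl⟩ | hd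
    · exact T.no_inversion g _ _ hvx ⟨rfl, hygx.symm⟩
    · have := hv x
      rw [← hygx] at this
      have hpl' : p.length = T.graph.dist v (g • v) := hpl
      omega
  refine ⟨v, p.length, hpos, fun n => ?_⟩
  cases n with
  | zero => simp
  | succ n =>
    obtain ⟨q, hq, hql, -⟩ := T.isTree.isAcyclic.exists_iterate_path (T.smulHom g)
      (T.smulHom_injective g) p hpath n
    have : (T.smulHom g)^[n + 1] v = g ^ (n + 1) • v := by
      have h : ⇑(T.smulHom g) = (g • ·) := rfl
      rw [h, smul_iterate]
    rw [← this, T.isTree.dist_eq_length hq, hql]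

/-- A point fixed by `g ^ n` would bound the displacement of `v` under all powers of `g ^ n`,
whereas it grows linearly. -/
theorem IsLoxodromic.pow {T : GTree G} {g : G} (hg : T.IsLoxodromic g) {n : ℕ} (hn : n ≠ 0) :
    T.IsLoxodromic (g ^ n) := by
  intro u hu
  obtain ⟨v, l, hl, h⟩ := T.exists_translation hg
  have hfix : ∀ k : ℕ, (g ^ n) ^ k • u = u := fun k => by
    induction k with
    | zero => simp
    | succ k ih => rw [pow_succ, mul_smul, hu, ih]
  set d := T.graph.dist v u
  have h1 := h (n * (2 * d + 1))
  have h2 : T.graph.dist v (g ^ (n * (2 * d + 1)) • v) ≤ d + d := by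
    refine (T.isTree.connected.dist_triangle (v := u)).trans (Nat.add_le_add_left ?_ _)
    rw [pow_mul]
    conv_lhs => rw [← hfix (2 * d + 1)]
    rw [dist_smul, SimpleGraph.dist_comm]
  rw [h1] at h2
  have : 1 * (2 * d + 1) ≤ n * (2 * d + 1) := Nat.mul_le_mul_right _ (by omega)
  have : n * (2 * d + 1) * 1 ≤ n * (2 * d + 1) * l := Nat.mul_le_mul_left _ hl
  omega

theorem IsLoxodromic.conj {T : GTree G} {g : G} (hg : T.IsLoxodromic g) (x : G) :
    T.IsLoxodromic (x * g * x⁻¹) := by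
  intro v hv
  apply hg (x⁻¹ • v)
  rw [mul_smul, mul_smul] at hv
  rw [eq_inv_smul_iff, hv]

/-- Conjugate powers of a loxodromic element have equal exponents. -/
theorem IsLoxodromic.exponent_le {T : GTree G} {g : G} (hg : T.IsLoxodromic g) {x : G} {p q : ℕ}
    (h : x * g ^ p * x⁻¹ = g ^ q ∨ x * g ^ p * x⁻¹ = (g ^ q)⁻¹) : q ≤ p := by
  obtain ⟨v, l, hl, hd⟩ := T.exists_translation hg
  set d := T.graph.dist v (x⁻¹ • v) with hdef
  -- The displacement of `v` by `x * g ^ (p * k) * x⁻¹` is computed exactly from the conjugation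
  -- relation, and estimated through `x⁻¹ • v`. The error `2 * d` does not depend on `k`.
  have key : ∀ k : ℕ, q * k * l ≤ p * k * l + 2 * d := by
    intro k
    have h1 : T.graph.dist v ((x * g ^ (p * k) * x⁻¹) • v) = q * k * l := by
      have h2 : x * g ^ (p * k) * x⁻¹ = (x * g ^ p * x⁻¹) ^ k := by
        rw [conj_pow, pow_mul]
      rw [h2]
      rcases h with h | h
      · rw [h, ← pow_mul, hd]
      · rw [h, inv_pow, ← T.dist_smul ((g ^ q) ^ k), smul_inv_smul, SimpleGraph.dist_comm,
          ← pow_mul, hd]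
    have h3 : T.graph.dist v ((x * g ^ (p * k) * x⁻¹) • v) =
        T.graph.dist (x⁻¹ • v) (g ^ (p * k) • x⁻¹ • v) := by
      rw [← T.dist_smul x⁻¹, ← mul_smul, ← mul_smul]
      congr 2
      group
    have h4 : T.graph.dist (x⁻¹ • v) (g ^ (p * k) • x⁻¹ • v) ≤ d + (p * k * l + d) := by
      refine (T.isTree.connected.dist_triangle (v := v)).trans ?_
      rw [SimpleGraph.dist_comm]
      refine Nat.add_le_add_left ?_ _
      refine (T.isTree.connected.dist_triangle (v := g ^ (p * k) • v)).trans ?_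
      rw [dist_smul, hd]
    omega
  by_contra hlt
  push Not at hlt
  have h5 := key (2 * d + 1)
  have h6 : (p + 1) * (2 * d + 1) * l ≤ q * (2 * d + 1) * l :=
    Nat.mul_le_mul_right _ (Nat.mul_le_mul_right _ hlt)
  have h7 : (2 * d + 1) * 1 ≤ (2 * d + 1) * l := Nat.mul_le_mul_left _ hl
  have h8 : (p + 1) * (2 * d + 1) * l = p * (2 * d + 1) * l + (2 * d + 1) * l := by ring
  omega

end GTree

/-! ### Commensurability -/

theorem mem_autImage_conj {G : Type u} [Group G] {x g : G} {B : Subgroup G} :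
    g ∈ autImage (MulAut.conj x) B ↔ x⁻¹ * g * x ∈ B := by
  rw [autImage, Subgroup.mem_map]
  constructor
  · rintro ⟨b, hb, rfl⟩
    simpa [MulAut.conj_apply, mul_assoc] using hb
  · intro h
    exact ⟨_, h, by simp [MulAut.conj_apply, mul_assoc]⟩

/-- An infinite subgroup of a cyclic group has finite index. -/
theorem relIndex_ne_zero_of_isCyclic {G : Type*} [Group G] {H K : Subgroup G} (hK : IsCyclic K)
    (hHK : H ≤ K) (hH : Infinite H) : H.relIndex K ≠ 0 := by
  obtain ⟨a, haH, ha⟩ : ∃ a ∈ H, a ≠ 1 := by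
    by_contra hcon
    push Not at hcon
    have : H = ⊥ := (Subgroup.eq_bot_iff_forall H).2 hcon
    subst this
    exact not_finite (⊥ : Subgroup G)
  obtain ⟨⟨t, ht⟩, hgen⟩ := hK.exists_generator
  obtain ⟨n, hn⟩ := Subgroup.mem_zpowers_iff.1 (hgen ⟨a, hHK haH⟩)
  have hn' : t ^ n = a := congrArg Subtype.val hn
  have hn0 : n ≠ 0 := by
    rintro rfl
    exact ha (by simpa using hn'.symm)
  let f : ℤ → K ⧸ H.subgroupOf K := fun i => QuotientGroup.mk (⟨t, ht⟩ ^ i)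
  have hmod : ∀ i, f i = f (i % n) := by
    intro i
    refine QuotientGroup.eq.2 ?_
    rw [Subgroup.mem_subgroupOf]
    have : (((⟨t, ht⟩ : K) ^ i)⁻¹ * ⟨t, ht⟩ ^ (i % n) : K) = ⟨t, ht⟩ ^ (n * (-(i / n))) := by
      rw [← zpow_neg, ← zpow_add]
      congr 1
      have := Int.emod_add_mul_ediv i n
      rw [mul_neg]
      omega
    rw [this, zpow_mul, Subgroup.coe_zpow, Subgroup.coe_zpow]
    change (t ^ n) ^ _ ∈ H
    rw [hn']
    exact H.zpow_mem haH _
  have hfin : Finite (K ⧸ H.subgroupOf K) := by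
    refine Set.finite_univ_iff.1 (Set.Finite.subset ((Set.finite_Ico (0 : ℤ) |n|).image f) ?_)
    rintro x -
    obtain ⟨k, rfl⟩ := QuotientGroup.mk_surjective x
    obtain ⟨i, rfl⟩ := Subgroup.mem_zpowers_iff.1 (hgen k)
    exact ⟨i % n, ⟨Int.emod_nonneg _ hn0, Int.emod_lt_abs _ hn0⟩, (hmod i).symm⟩
  rw [Subgroup.relIndex]
  exact Subgroup.index_ne_zero_of_finite

theorem commensurable_of_le {G : Type*} [Group G] {H K : Subgroup G} (hHK : H ≤ K)
    (h : H.relIndex K ≠ 0) : Subgroup.Commensurable H K :=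
  ⟨h, by rw [Subgroup.relIndex_eq_one.2 hHK]; exact one_ne_zero⟩

theorem commensurable_inf_left {G : Type*} [Group G] {H K : Subgroup G}
    (h : Subgroup.Commensurable H K) : Subgroup.Commensurable (H ⊓ K) H :=
  commensurable_of_le inf_le_left (by rw [Subgroup.inf_relIndex_left]; exact h.2)

theorem infinite_of_commensurable {G : Type*} [Group G] {H K : Subgroup G}
    (h : Subgroup.Commensurable H K) (hK : Infinite K) : Infinite H := by
  by_contra hcon
  rw [not_infinite_iff_finite] at hcon
  have h1 : (H ⊓ K).relIndex K ≠ 0 := by rw [Subgroup.inf_relIndex_right]; exact h.1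
  have h2 : Finite ((H ⊓ K : Subgroup G)) := Finite.Set.subset (H : Set G) inf_le_left
  have h3 : Finite ((H ⊓ K).subgroupOf K) :=
    Finite.of_injective (fun x => (⟨x.1.1, x.2⟩ : (H ⊓ K : Subgroup G))) fun x y hxy => by
      apply Subtype.ext
      apply Subtype.ext
      exact congrArg (fun z : (H ⊓ K : Subgroup G) => (z : G)) hxy
  have h4 : Finite (K ⧸ (H ⊓ K).subgroupOf K) := by
    rw [Subgroup.relIndex] at h1
    have : ((H ⊓ K).subgroupOf K).FiniteIndex := ⟨h1⟩
    exact Subgroup.finite_quotient_of_finiteIndex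
  have : Finite K := Finite.of_equiv _ (Subgroup.groupEquivQuotientProdSubgroup
    (s := (H ⊓ K).subgroupOf K)).symm
  exact not_finite K

/-- Every element of a subgroup conjugates some positive power of `a` to a power of `a`. -/
def IsCommensuratedElement {G : Type*} [Group G] (a : G) : Prop :=
  ∀ x : G, ∃ p : ℕ, p ≠ 0 ∧ ∃ m : ℤ, x * a ^ p * x⁻¹ = a ^ m

theorem IsCommensuratedElement.map {G : Type*} [Group G] {a : G} (h : IsCommensuratedElement a)
    (φ : MulAut G) : IsCommensuratedElement (φ a) := by
  intro x
  obtain ⟨p, hp, m, hm⟩ := h (φ⁻¹ x)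
  refine ⟨p, hp, m, ?_⟩
  have := congrArg φ hm
  simpa using this

/-! ### Commensurable stabilizers and local finiteness of GBS trees -/

namespace GTree

variable {G : Type u} [Group G]

theorem vertexStab_smul (T : GTree G) (g : G) (v : T.V) :
    T.vertexStab (g • v) = autImage (MulAut.conj g) (T.vertexStab v) := by
  ext x
  rw [mem_autImage_conj, mem_vertexStab, mem_vertexStab, mul_smul, mul_smul, inv_smul_eq_iff]

theorem isElliptic_vertexStab (T : GTree G) (v : T.V) : T.IsElliptic (T.vertexStab v) :=
  ⟨v, le_rfl⟩

theorem IsElliptic.mono {T : GTree G} {H K : Subgroup G} (hK : T.IsElliptic K) (h : H ≤ K) :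
    T.IsElliptic H :=
  let ⟨v, hv⟩ := hK
  ⟨v, h.trans hv⟩

theorem isElliptic_zpowers {T : GTree G} {g : G} :
    T.IsElliptic (Subgroup.zpowers g) ↔ ¬ T.IsLoxodromic g := by
  simp only [IsElliptic, IsLoxodromic, Subgroup.zpowers_le, mem_vertexStab, not_forall, not_not,
    ne_eq]

theorem isLoxodromic_congr {T S : GTree G} (h : ∀ H : Subgroup G, S.IsElliptic H ↔ T.IsElliptic H)
    {g : G} : S.IsLoxodromic g ↔ T.IsLoxodromic g := by
  have := h (Subgroup.zpowers g)
  rw [isElliptic_zpowers, isElliptic_zpowers] at this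
  exact not_iff_not.1 this

theorem mem_deformationSpace_self {T : GTree G} (hT : T.IsGBSTree) : T ∈ T.deformationSpace :=
  ⟨hT, fun _ => Iff.rfl⟩

theorem IsGBSTree.commensurable {S : GTree G} (hS : S.IsGBSTree) (v w : S.V) :
    Subgroup.Commensurable (S.vertexStab v) (S.vertexStab w) := by
  obtain ⟨p⟩ := S.isTree.connected.preconnected v w
  induction p with
  | nil => exact Subgroup.Commensurable.refl _
  | @cons a b c hab p ih =>
    refine Subgroup.Commensurable.trans ?_ ih
    have he := hS.edge_cyclic a b hab
    exact (commensurable_of_le inf_le_left (relIndex_ne_zero_of_isCyclic (hS.vertex_cyclic a).1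
      inf_le_left he.2)).symm.trans (commensurable_of_le inf_le_right
      (relIndex_ne_zero_of_isCyclic (hS.vertex_cyclic b).1 inf_le_right he.2))

/-- A vertex group of `S` is elliptic in `S'`, hence an infinite subgroup of a cyclic vertex group
of `S'`, hence of finite index in it. -/
theorem commensurable_of_mem {T S S' : GTree G} (hS : S ∈ T.deformationSpace)
    (hS' : S' ∈ T.deformationSpace) (v : S.V) (w : S'.V) :
    Subgroup.Commensurable (S.vertexStab v) (S'.vertexStab w) := by
  obtain ⟨w', hw'⟩ := (hS'.2 _).2 ((hS.2 _).1 (S.isElliptic_vertexStab v))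
  exact (commensurable_of_le hw' (relIndex_ne_zero_of_isCyclic (hS'.1.vertex_cyclic w').1 hw'
    (hS.1.vertex_cyclic v).2)).trans (hS'.1.commensurable w' w)

theorem IsGBSTree.isCommensuratedElement {S : GTree G} (hS : S.IsGBSTree) {v : S.V} {a : G}
    (ha : a ∈ S.vertexStab v) : IsCommensuratedElement a := by
  intro x
  by_cases ha1 : a = 1
  · exact ⟨1, one_ne_zero, 1, by simp [ha1]⟩
  obtain ⟨⟨t, ht⟩, hgen⟩ := (hS.vertex_cyclic v).1.exists_generator
  have hgen' : ∀ b ∈ S.vertexStab v, ∃ k : ℤ, t ^ k = b := fun b hb => by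
    obtain ⟨k, hk⟩ := Subgroup.mem_zpowers_iff.1 (hgen ⟨b, hb⟩)
    exact ⟨k, congrArg Subtype.val hk⟩
  obtain ⟨k, rfl⟩ := hgen' a ha
  have hk : k ≠ 0 := by
    rintro rfl
    exact ha1 (zpow_zero t)
  have hx : x * t ^ k * x⁻¹ ∈ S.vertexStab (x • v) := by
    rw [vertexStab_smul, mem_autImage_conj]
    simpa [mul_assoc] using ha
  obtain ⟨n, hn, -, hmem⟩ := Subgroup.exists_pow_mem_of_relIndex_ne_zero
    (hS.commensurable v (x • v)).1 hx
  obtain ⟨m, hm⟩ := hgen' _ hmem.1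
  refine ⟨n * k.natAbs, Nat.mul_ne_zero (by omega) (Int.natAbs_ne_zero.2 hk), m * k.sign, ?_⟩
  have h1 : x * (t ^ k) ^ (n * k.natAbs) * x⁻¹ = ((x * t ^ k * x⁻¹) ^ n) ^ k.natAbs := by
    rw [← pow_mul, conj_pow]
  rw [h1, ← hm, ← zpow_natCast, ← zpow_mul, ← zpow_mul]
  congr 1
  rw [← Int.mul_sign_self k]
  ring

/-- The edges starting at `v` in one `G`-orbit form one orbit of the stabilizer of `v`; it is finite
because edge groups have finite index in vertex groups. -/
theorem IsGBSTree.neighbor_finite {S : GTree G} (hS : S.IsGBSTree) (v : S.V) :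
    {w | S.graph.Adj v w}.Finite := by
  obtain ⟨-, s, hs, hcov⟩ := hS.cocompact
  have key : ∀ e ∈ s, {w | S.graph.Adj v w ∧ ∃ g : G, (g • v, g • w) = e}.Finite := by
    rintro ⟨a, b⟩ -
    by_cases hne : {w | S.graph.Adj v w ∧ ∃ g : G, (g • v, g • w) = (a, b)}.Nonempty
    · obtain ⟨w₀, hw₀, g₀, hg₀⟩ := hne
      rw [Prod.mk.injEq] at hg₀
      have hfi : (MulAction.stabilizer (S.vertexStab v) w₀).index ≠ 0 := by
        have h1 := relIndex_ne_zero_of_isCyclic (hS.vertex_cyclic v).1 inf_le_left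
          (hS.edge_cyclic v w₀ hw₀).2
        have h2 : MulAction.stabilizer (S.vertexStab v) w₀ =
            (S.edgeStab v w₀).subgroupOf (S.vertexStab v) := by
          ext g
          exact ⟨fun h => ⟨g.2, h⟩, fun h => h.2⟩
        rw [h2]
        exact h1
      have horb : (MulAction.orbit (S.vertexStab v) w₀).Finite := by
        have : (MulAction.stabilizer (S.vertexStab v) w₀).FiniteIndex := ⟨hfi⟩
        exact Set.finite_coe_iff.1 (Finite.of_equiv _
          (MulAction.orbitEquivQuotientStabilizer (S.vertexStab v) w₀).symm)
      refine horb.subset ?_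
      rintro w ⟨-, g, hg⟩
      rw [Prod.mk.injEq] at hg
      refine ⟨⟨g⁻¹ * g₀, ?_⟩, ?_⟩
      · rw [mem_vertexStab, mul_smul, hg₀.1, inv_smul_eq_iff, hg.1]
      · change (g⁻¹ * g₀) • w₀ = w
        rw [mul_smul, hg₀.2, inv_smul_eq_iff, hg.2]
    · rw [Set.not_nonempty_iff_eq_empty] at hne
      rw [hne]
      exact Set.finite_empty
  refine (hs.biUnion key).subset fun w hw => ?_
  obtain ⟨g, hg⟩ := hcov v w hw
  exact Set.mem_biUnion hg ⟨hw, g, rfl⟩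

theorem IsGBSTree.ball_finite {S : GTree G} (hS : S.IsGBSTree) (v : S.V) (n : ℕ) :
    {w | S.graph.dist v w ≤ n}.Finite := by
  induction n with
  | zero =>
    refine (Set.finite_singleton v).subset fun w hw => ?_
    have : S.graph.dist v w = 0 := Nat.le_zero.1 hw
    exact (S.isTree.connected.dist_eq_zero_iff.1 this).symm
  | succ n ih =>
    refine (ih.union (ih.biUnion fun w _ => hS.neighbor_finite w)).subset fun w hw => ?_
    obtain ⟨p, hp⟩ := S.isTree.connected.exists_walk_length_eq_dist w v
    cases p with
    | nil => exact Or.inl (by simp)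
    | @cons _ x _ hwx p =>
      refine Or.inr (Set.mem_biUnion (x := x) ?_ hwx.symm)
      have h1 := SimpleGraph.dist_le p
      rw [Walk.length_cons, SimpleGraph.dist_comm] at hp
      rw [SimpleGraph.dist_comm] at h1
      have hw' : S.graph.dist v w ≤ n + 1 := hw
      change S.graph.dist v x ≤ n
      omega

/-! ### Blocks and commensurated elements -/

/-- `Y` is a subtree with stabilizer `B` whose translates are equal or disjoint. -/
structure IsBlock (S : GTree G) (Y : Set S.V) (B : Subgroup G) : Prop where
  subtree : S.graph.IsSubtree Y
  smul_mem : ∀ g ∈ B, ∀ y ∈ Y, g • y ∈ Y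
  mem_of : ∀ (g : G), ∀ y ∈ Y, g • y ∈ Y → g ∈ B

namespace IsBlock

variable {S : GTree G} {Y : Set S.V} {B : Subgroup G}

theorem smul_mem_iff (hY : S.IsBlock Y B) {g : G} (hg : g ∈ B) (y : S.V) : g • y ∈ Y ↔ y ∈ Y :=
  ⟨fun h => by simpa using hY.smul_mem g⁻¹ (B.inv_mem hg) _ h, hY.smul_mem g hg y⟩

theorem vertexStab_le (hY : S.IsBlock Y B) {y : S.V} (hy : y ∈ Y) : S.vertexStab y ≤ B :=
  fun g hg => hY.mem_of g y hy (by rw [mem_vertexStab.1 hg]; exact hy)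

theorem translate (hY : S.IsBlock Y B) (x : G) :
    S.IsBlock {v | x⁻¹ • v ∈ Y} (autImage (MulAut.conj x) B) where
  subtree := by
    obtain ⟨y, hy⟩ := hY.subtree.1
    refine ⟨⟨x • y, by simpa using hy⟩, fun a ha b hb => ?_⟩
    obtain ⟨p, hp⟩ := hY.subtree.2 _ ha _ hb
    obtain ⟨q, -, hq⟩ := S.exists_smul_walk x p
    refine ⟨q.copy (smul_inv_smul x a) (smul_inv_smul x b), fun z hz => ?_⟩
    rw [Walk.support_copy] at hz
    obtain ⟨w, hw, rfl⟩ := hq z hz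
    simpa using hp w hw
  smul_mem g hg y hy := by
    rw [mem_autImage_conj] at hg
    have := hY.smul_mem _ hg _ hy
    simpa [mul_smul] using this
  mem_of g y hy hgy := by
    rw [mem_autImage_conj]
    refine hY.mem_of _ _ hy ?_
    simpa [mul_smul] using hgy

/-- Comparing exponents for `h` and `h⁻¹` shows that `h` conjugates `a ^ p` to itself or its
inverse, so `h ^ 2` commutes with `a ^ p`. The loxodromic element `h ^ 2` thus preserves both `Y`
and its translate by `a ^ p`. These must meet, so they coincide. -/
theorem exists_pow_mem (hY : S.IsBlock Y B) {h : G} (hB : h ∈ B) (hh : S.IsLoxodromic h) {a : G}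
    (ha : IsCommensuratedElement a) (hlox : S.IsLoxodromic a) : ∃ p : ℕ, p ≠ 0 ∧ a ^ p ∈ B := by
  obtain ⟨p, hp, m, hm⟩ := ha h
  refine ⟨p, hp, ?_⟩
  have hm1 : h * a ^ p * h⁻¹ = a ^ m.natAbs ∨ h * a ^ p * h⁻¹ = (a ^ m.natAbs)⁻¹ := by
    rcases Int.natAbs_eq m with h1 | h1
    · left; rw [hm, h1, zpow_natCast, Int.natAbs_natCast]
    · right; rw [hm, h1, zpow_neg, zpow_natCast, Int.natAbs_neg, Int.natAbs_natCast]
  have hle := hlox.exponent_le hm1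
  have hm2 : h⁻¹ * a ^ m.natAbs * h⁻¹⁻¹ = a ^ p ∨ h⁻¹ * a ^ m.natAbs * h⁻¹⁻¹ = (a ^ p)⁻¹ := by
    rcases hm1 with h1 | h1
    · left; rw [← h1]; group
    · right; rw [← inv_inj, inv_inv, mul_inv_rev, mul_inv_rev, ← h1]; group
  have heq : m.natAbs = p := le_antisymm hle (hlox.exponent_le hm2)
  rw [heq] at hm1
  have hcomm : h ^ 2 * a ^ p = a ^ p * h ^ 2 := by
    have h3 : h * (a ^ p)⁻¹ * h⁻¹ = (h * a ^ p * h⁻¹)⁻¹ := by group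
    have h2 : h * (h * a ^ p * h⁻¹) * h⁻¹ = a ^ p := by
      rcases hm1 with h1 | h1
      · rw [h1, h1]
      · rw [h1, h3, h1, inv_inv]
    calc h ^ 2 * a ^ p = h * (h * a ^ p * h⁻¹) * h⁻¹ * h ^ 2 := by
          simp only [pow_two, mul_assoc, inv_mul_cancel_left, inv_mul_cancel, mul_one]
      _ = a ^ p * h ^ 2 := by rw [h2]
  have hB2 : h ^ 2 ∈ B := B.pow_mem hB 2
  have hY' := hY.translate (a ^ p)
  have hmem : h ^ 2 ∈ autImage (MulAut.conj (a ^ p)) B := by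
    rw [mem_autImage_conj, mul_assoc, hcomm, inv_mul_cancel_left]
    exact hB2
  obtain ⟨y, hy, hy'⟩ := S.inter_nonempty_of_loxodromic hY.subtree hY'.subtree
    (hh.pow two_ne_zero) (hY.smul_mem_iff hB2) (hY'.smul_mem_iff hmem)
  have := hY.mem_of _ _ hy hy'
  simpa using B.inv_mem this

/-- In the presence of a proper block containing a loxodromic element, commensurated elements are
elliptic. -/
theorem not_isLoxodromic (hY : S.IsBlock Y B) {h : G} (hB : h ∈ B) (hh : S.IsLoxodromic h)
    (hne : B ≠ ⊤) {a : G} (ha : IsCommensuratedElement a) : ¬ S.IsLoxodromic a := by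
  intro hlox
  obtain ⟨x, hx⟩ : ∃ x, x ∉ B := by
    by_contra hcon
    push Not at hcon
    exact hne ((Subgroup.eq_top_iff' B).2 hcon)
  -- A power of `a` lies in both `B` and its conjugate by `x`. Being loxodromic, it forces `Y` and
  -- `x • Y` to meet, which puts `x` in `B`.
  have hY' := hY.translate x
  obtain ⟨p, hp, hpB⟩ := hY.exists_pow_mem hB hh ha hlox
  obtain ⟨q, hq, hqB⟩ := hY'.exists_pow_mem (h := x * h * x⁻¹)
    (mem_autImage_conj.2 (by simpa [mul_assoc] using hB)) (hh.conj x) ha hlox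
  have h1 : a ^ (p * q) ∈ B := by rw [pow_mul]; exact B.pow_mem hpB q
  have h2 : a ^ (p * q) ∈ autImage (MulAut.conj x) B := by
    rw [mul_comm, pow_mul]
    exact Subgroup.pow_mem _ hqB p
  obtain ⟨y, hy, hy'⟩ := S.inter_nonempty_of_loxodromic hY.subtree hY'.subtree
    (hlox.pow (mul_ne_zero hp hq)) (hY.smul_mem_iff h1) (hY'.smul_mem_iff h2)
  have := hY.mem_of _ _ hy hy'
  exact hx (by simpa using B.inv_mem this)

/-- A block contains the stabilizer of every path from a vertex to its image under a loxodromic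
element. -/
theorem inf_conj_le (hY : S.IsBlock Y B) {x : G} (hx : x ∈ B) (hlox : S.IsLoxodromic x)
    {H : Subgroup G} (hH : S.IsElliptic H) : H ⊓ autImage (MulAut.conj x) H ≤ B := by
  obtain ⟨w, hw⟩ := hH
  obtain ⟨π, hπ, hall⟩ := S.exists_mem_all_walks hY.subtree hlox (hY.smul_mem_iff hx) w
  obtain ⟨p, -, hp⟩ := S.exists_fixed_walk w (x • w)
  rintro k ⟨hk1, hk2⟩
  have h1 : k • w = w := hw hk1
  have h2 : k • x • w = x • w := by
    have := hw (mem_autImage_conj.1 hk2)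
    rw [mem_vertexStab, mul_smul, mul_smul, inv_smul_eq_iff] at this
    exact this
  refine hY.mem_of k π hπ ?_
  rw [hp k h1 h2 π (hall p)]
  exact hπ

end IsBlock

end GTree

theorem exists_forall_le_nat {α : Type*} (P : α → Prop) (f : α → ℕ) (h : ∃ a, P a) :
    ∃ a, P a ∧ ∀ b, P b → f a ≤ f b := by
  obtain ⟨a, ha⟩ := h
  obtain ⟨b, hb, hmin⟩ := (measure f).wf.has_min {a | P a} ⟨a, ha⟩
  exact ⟨b, hb, fun c hc => not_lt.1 (hmin c hc)⟩

namespace SimpleGraph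

variable {V : Type*} {Γ : SimpleGraph V}

theorem IsTree.mem_support_of_isPath (hΓ : Γ.IsTree) {a b : V} {p : Γ.Walk a b} (hp : p.IsPath)
    {x : V} (hx : x ∈ p.support) (q : Γ.Walk a b) : x ∈ q.support := by
  classical
  rw [(hΓ.existsUnique_path a b).unique hp q.bypass_isPath] at hx
  exact q.support_bypass_subset_support hx

theorem IsSubtree.preimage_val {Y Z : Set V} (hY : Γ.IsSubtree Y) (h : Y ⊆ Z) :
    (Γ.induce Z).IsSubtree (Subtype.val ⁻¹' Y) := by
  obtain ⟨y, hy⟩ := hY.1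
  refine ⟨⟨⟨y, h hy⟩, hy⟩, fun a ha b hb => ?_⟩
  obtain ⟨p, hp⟩ := hY.2 a ha b hb
  refine ⟨p.induce Z fun x hx => h (hp x hx), fun x hx => ?_⟩
  rw [Walk.support_induce, List.mem_attachWith] at hx
  exact hp _ hx

theorem IsSubtree.image_val {Z : Set V} {Y : Set Z} (hY : (Γ.induce Z).IsSubtree Y) :
    Γ.IsSubtree (Subtype.val '' Y) := by
  obtain ⟨y, hy⟩ := hY.1
  refine ⟨⟨y, y, hy, rfl⟩, ?_⟩
  rintro _ ⟨a, ha, rfl⟩ _ ⟨b, hb, rfl⟩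
  obtain ⟨p, hp⟩ := hY.2 a ha b hb
  refine ⟨p.map (Embedding.induce Z).toHom, fun x hx => ?_⟩
  have hx' : x ∈ (p.map (Embedding.induce Z).toHom).support := hx
  rw [Walk.support_map, List.mem_map] at hx'
  obtain ⟨z, hz, rfl⟩ := hx'
  exact ⟨z, hp z hz, rfl⟩

end SimpleGraph

/-! ### Collapses, blocks and invariant subtrees -/

namespace GTree

variable {G : Type u} [Group G]

theorem IsCollapse.isBlock {S S' : GTree G} {c : S.V → S'.V} (hc : IsCollapse S S' c) (x : S'.V) :
    S.IsBlock (c ⁻¹' {x}) (S'.vertexStab x) where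
  subtree := isSubtree_iff.2 (hc.fibre x)
  smul_mem g hg y hy := by
    rw [Set.mem_preimage, Set.mem_singleton_iff] at hy ⊢
    rw [hc.equivariant, hy]
    exact hg
  mem_of g y hy hgy := by
    rw [Set.mem_preimage, Set.mem_singleton_iff] at hy hgy
    rw [hc.equivariant, hy] at hgy
    exact hgy

/-- The action on the quotient by an invariant equivalence relation. -/
@[reducible] def quotientAction (S : GTree G) (r : Setoid S.V) (hr : ∀ (g : G) x y, r x y → r (g • x) (g • y)) :
    MulAction G (Quotient r) where
  smul g := Quotient.map (g • ·) (fun x y h => hr g x y h)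
  one_smul q := by
    induction q using Quotient.inductionOn with
    | h x => exact congrArg (Quotient.mk r) (one_smul G x)
  mul_smul g h q := by
    induction q using Quotient.inductionOn with
    | h x => exact congrArg (Quotient.mk r) (mul_smul g h x)

/-- The graph obtained by collapsing equivalence classes. -/
def quotientGraph (S : GTree G) (r : Setoid S.V) : SimpleGraph (Quotient r) where
  Adj a b := a ≠ b ∧ ∃ x y, Quotient.mk r x = a ∧ Quotient.mk r y = b ∧ S.graph.Adj x y
  symm := ⟨fun _ _ ⟨h, x, y, hx, hy, hxy⟩ => ⟨h.symm, y, x, hy, hx, hxy.symm⟩⟩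
  loopless := ⟨fun _ h => h.1 rfl⟩

/-- The two sides of an edge between different classes are unions of classes. -/
theorem exists_saturated_cut (S : GTree G) (r : Setoid S.V)
    (hconn : ∀ x, S.graph.IsSubtree {y | r x y}) {x y : S.V} (hxy : S.graph.Adj x y)
    (hne : ¬ r x y) :
    ∃ R : Set S.V, y ∈ R ∧ x ∉ R ∧ (∀ a b, S.graph.Adj a b → a ∈ R → b ∉ R → a = y ∧ b = x) ∧
      ∀ a b, r a b → a ∈ R → b ∈ R := by
  obtain ⟨R, hy, hx, hR⟩ := S.isTree.isAcyclic.exists_cut hxy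
  refine ⟨R, hy, hx, hR, fun a b hab ha => ?_⟩
  refine (hconn a).subset_of_closed (r.refl a) ha (fun c hc d hd hcd hcR => ?_) hab
  by_contra hdR
  obtain ⟨rfl, rfl⟩ := hR c d hcd hcR hdR
  exact hne (r.trans (r.symm hd) hc)

/-- The tree obtained by collapsing the classes of an invariant equivalence relation with
connected classes. -/
def collapse (S : GTree G) (r : Setoid S.V) (hr : ∀ (g : G) x y, r x y → r (g • x) (g • y))
    (hconn : ∀ x, S.graph.IsSubtree {y | r x y}) : GTree G where
  V := Quotient r
  act := S.quotientAction r hr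
  graph := S.quotientGraph r
  isTree := by
    refine (isTree_iff _).2 ⟨?_, isAcyclic_of_cuts ?_⟩
    · obtain ⟨v⟩ := S.isTree.connected.nonempty
      have : Nonempty (Quotient r) := ⟨Quotient.mk r v⟩
      refine ⟨fun a b => ?_⟩
      induction a using Quotient.inductionOn with
      | h a =>
        induction b using Quotient.inductionOn with
        | h b =>
          obtain ⟨q, -⟩ := (S.isTree.connected.preconnected a b).some.exists_lazy_map
            (Δ := S.quotientGraph r) (Quotient.mk r) fun x y hxy => by
              by_cases h : Quotient.mk r x = Quotient.mk r y
              · exact Or.inl h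
              · exact Or.inr ⟨h, x, y, rfl, rfl, hxy⟩
          exact ⟨q⟩
    · rintro _ _ ⟨hne, x, y, rfl, rfl, hxy⟩
      obtain ⟨R, hy, hx, hR, hsat⟩ := S.exists_saturated_cut r hconn hxy
        (fun h => hne (Quotient.sound h))
      refine ⟨Quotient.mk r '' R, ⟨y, hy, rfl⟩, ?_, ?_⟩
      · rintro ⟨u, hu, hux⟩
        exact hx (hsat u x (Quotient.exact hux) hu)
      · rintro _ _ ⟨-, u, v, rfl, rfl, huv⟩ ⟨w, hw, hwu⟩ hv
        have huR := hsat w u (Quotient.exact hwu) hw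
        obtain ⟨rfl, rfl⟩ := hR u v huv huR (fun hvR => hv ⟨v, hvR, rfl⟩)
        exact ⟨rfl, rfl⟩
  adj_smul := by
    rintro g _ _ ⟨hne, x, y, rfl, rfl, hxy⟩
    refine ⟨fun h => hne ?_, g • x, g • y, rfl, rfl, S.adj_smul g x y hxy⟩
    have h1 : r (g • x) (g • y) := Quotient.exact h
    have h2 := hr g⁻¹ _ _ h1
    rw [inv_smul_smul, inv_smul_smul] at h2
    exact Quotient.sound h2
  no_inversion := by
    rintro g _ _ ⟨hne, x, y, rfl, rfl, hxy⟩ ⟨h1, h2⟩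
    obtain ⟨R, hy, hx, hR, hsat⟩ := S.exists_saturated_cut r hconn hxy
      (fun h => hne (Quotient.sound h))
    have h1' : r (g • x) y := Quotient.exact h1
    have h2' : r (g • y) x := Quotient.exact h2
    have hgx : g • x ∈ R := hsat y _ (r.symm h1') hy
    have hgy : g • y ∉ R := fun h => hx (hsat _ x h2' h)
    obtain ⟨ha, hb⟩ := hR _ _ (S.adj_smul g x y hxy) hgx hgy
    exact S.no_inversion g x y hxy ⟨ha, hb⟩

theorem isCollapse_collapse (S : GTree G) (r : Setoid S.V)
    (hr : ∀ (g : G) x y, r x y → r (g • x) (g • y))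
    (hconn : ∀ x, S.graph.IsSubtree {y | r x y}) :
    IsCollapse S (S.collapse r hr hconn) (Quotient.mk r) where
  surjective := Quotient.mk_surjective
  equivariant _ _ := rfl
  edge x y hxy := by
    by_cases h : Quotient.mk r x = Quotient.mk r y
    · exact Or.inl h
    · exact Or.inr ⟨h, x, y, rfl, rfl, hxy⟩
  fibre q := by
    induction q using Quotient.inductionOn with
    | h x =>
      rw [← isSubtree_iff]
      convert hconn x using 1
      ext y
      exact ⟨fun h => r.symm (Quotient.exact h), fun h => Quotient.sound (r.symm h)⟩

/-- The equivalence relation whose classes are the translates of a block and singletons. -/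
def blockSetoid (S : GTree G) (Y : Set S.V) (B : Subgroup G) (hY : S.IsBlock Y B) :
    Setoid S.V where
  r x y := x = y ∨ ∃ g : G, g • x ∈ Y ∧ g • y ∈ Y
  iseqv := by
    refine ⟨fun x => Or.inl rfl, ?_, ?_⟩
    · rintro x y (rfl | ⟨g, h1, h2⟩)
      · exact Or.inl rfl
      · exact Or.inr ⟨g, h2, h1⟩
    · rintro x y z (rfl | ⟨g, h1, h2⟩) (rfl | ⟨k, h3, h4⟩)
      · exact Or.inl rfl
      · exact Or.inr ⟨k, h3, h4⟩
      · exact Or.inr ⟨g, h1, h2⟩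
      · have hk : k * g⁻¹ ∈ B := hY.mem_of _ _ h2 (by rw [mul_smul, inv_smul_smul]; exact h3)
        refine Or.inr ⟨k, ?_, h4⟩
        have := hY.smul_mem _ hk _ h1
        rwa [mul_smul, inv_smul_smul] at this

/-- A block is a fibre of a collapse map. -/
theorem IsBlock.exists_collapse {S : GTree G} {Y : Set S.V} {B : Subgroup G}
    (hY : S.IsBlock Y B) :
    ∃ (S' : GTree G) (c : S.V → S'.V), IsCollapse S S' c ∧ ∃ x : S'.V, B = S'.vertexStab x := by
  set r := S.blockSetoid Y B hY with hrdef
  have hr : ∀ (g : G) x y, r x y → r (g • x) (g • y) := by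
    rintro g x y (rfl | ⟨k, h1, h2⟩)
    · exact Or.inl rfl
    · refine Or.inr ⟨k * g⁻¹, ?_, ?_⟩ <;> rwa [mul_smul, inv_smul_smul]
  have hconn : ∀ x, S.graph.IsSubtree {y | r x y} := by
    intro x
    by_cases hx : ∃ g : G, g • x ∈ Y
    · obtain ⟨g, hg⟩ := hx
      convert (hY.translate g⁻¹).subtree using 1
      ext y
      rw [Set.mem_ofPred_eq, Set.mem_ofPred_eq, inv_inv]
      constructor
      · rintro (rfl | ⟨k, h1, h2⟩)
        · exact hg
        · have hk : g * k⁻¹ ∈ B := hY.mem_of _ _ h1 (by rw [mul_smul, inv_smul_smul]; exact hg)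
          have := hY.smul_mem _ hk _ h2
          rwa [mul_smul, inv_smul_smul] at this
      · exact fun h => Or.inr ⟨g, hg, h⟩
    · convert_to S.graph.IsSubtree {x}
      · ext y
        constructor
        · rintro (rfl | ⟨k, h1, -⟩)
          · rfl
          · exact absurd ⟨k, h1⟩ hx
        · rintro rfl
          exact Or.inl rfl
      · refine ⟨⟨x, rfl⟩, ?_⟩
        rintro a rfl b rfl
        exact ⟨Walk.nil, by simp⟩
  obtain ⟨y, hy⟩ := hY.subtree.1
  refine ⟨S.collapse r hr hconn, Quotient.mk r, S.isCollapse_collapse r hr hconn,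
    Quotient.mk r y, ?_⟩
  ext g
  constructor
  · intro hg
    exact Quotient.sound (s := r) (Or.inr ⟨1, by simpa using hY.smul_mem g hg y hy, by simpa using hy⟩)
  · intro hg
    have h1 : r (g • y) y := Quotient.exact hg
    rcases h1 with h1 | ⟨k, h1, h2⟩
    · exact hY.mem_of g y hy (by rw [h1]; exact hy)
    · have hk : k ∈ B := hY.mem_of k y hy h2
      have := hY.smul_mem _ (B.inv_mem hk) _ h1
      rw [inv_smul_smul] at this
      exact hY.mem_of g y hy this

/-- This form dispenses with the collapsed tree, so that special factors can be carried to glued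
trees, subtrees and twisted actions. -/
theorem isSpecialFactor_iff {T : GTree G} {𝓐 : Set (Subgroup G)} {B : Subgroup G} :
    T.IsSpecialFactor 𝓐 B ↔ ¬ T.IsElliptic B ∧
      ∃ S ∈ T.restrictedSpace 𝓐, ∃ Y : Set S.V, S.IsBlock Y B := by
  constructor
  · rintro ⟨h1, S, hS, S', c, hc, x, rfl⟩
    exact ⟨h1, S, hS, _, hc.isBlock x⟩
  · rintro ⟨h1, S, hS, Y, hY⟩
    exact ⟨h1, S, hS, hY.exists_collapse⟩

/-- The restriction of the action to an invariant subtree. -/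
def restrict (S : GTree G) (Z : Set S.V) (hZ : S.graph.IsSubtree Z)
    (hinv : ∀ (g : G), ∀ z ∈ Z, g • z ∈ Z) : GTree G where
  V := Z
  act :=
    { smul := fun g z => ⟨g • z.1, hinv g z.1 z.2⟩
      one_smul := fun z => Subtype.ext (one_smul G z.1)
      mul_smul := fun g h z => Subtype.ext (mul_smul g h z.1) }
  graph := S.graph.induce Z
  isTree := (isTree_iff _).2 ⟨isSubtree_iff.1 hZ, S.isTree.isAcyclic.induce Z⟩
  adj_smul g v w h := S.adj_smul g v.1 w.1 h
  no_inversion g v w h h' :=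
    S.no_inversion g v.1 w.1 h ⟨congrArg Subtype.val h'.1, congrArg Subtype.val h'.2⟩

theorem restrict_minimal (S : GTree G) {Z : Set S.V} (hZ : S.graph.IsSubtree Z)
    (hinv : ∀ (g : G), ∀ z ∈ Z, g • z ∈ Z)
    (hmin : ∀ Z' ⊆ Z, S.graph.IsSubtree Z' → (∀ (g : G), ∀ z ∈ Z', g • z ∈ Z') → Z' = Z) :
    (S.restrict Z hZ hinv).IsMinimal := by
  intro s hs hconn
  have h1 : (S.graph.induce Z).IsSubtree s := isSubtree_iff.2 hconn
  have h2 := hmin (Subtype.val '' s) (by rintro _ ⟨z, -, rfl⟩; exact z.2) h1.image_val (by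
    rintro g _ ⟨z, hz, rfl⟩
    exact ⟨_, hs g z hz, rfl⟩)
  ext z
  simp only [Set.mem_univ, iff_true]
  have h3 : z.1 ∈ Subtype.val '' s := by rw [h2]; exact z.2
  obtain ⟨z', hz', h4⟩ := h3
  rwa [← Subtype.ext h4]

theorem restrict_cocompact (S : GTree G) {Z : Set S.V} (hZ : S.graph.IsSubtree Z)
    (hinv : ∀ (g : G), ∀ z ∈ Z, g • z ∈ Z)
    (hv : ∃ F : Set S.V, F.Finite ∧ ∀ z ∈ Z, ∃ g : G, g • z ∈ F)
    (he : ∃ E : Set (S.V × S.V), E.Finite ∧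
      ∀ z ∈ Z, ∀ z' ∈ Z, S.graph.Adj z z' → ∃ g : G, (g • z, g • z') ∈ E) :
    (S.restrict Z hZ hinv).IsCocompact := by
  obtain ⟨F, hF, hFc⟩ := hv
  obtain ⟨E, hE, hEc⟩ := he
  refine ⟨⟨Subtype.val ⁻¹' F, hF.preimage Subtype.val_injective.injOn, fun z => hFc z.1 z.2⟩,
    ⟨(Prod.map Subtype.val Subtype.val) ⁻¹' E,
      hE.preimage (Subtype.val_injective.prodMap Subtype.val_injective).injOn, fun z z' h =>
      hEc z.1 z.2 z'.1 z'.2 h⟩⟩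

end GTree

theorem isCyclic_of_subgroup_le {G : Type*} [Group G] {H K : Subgroup G} (hK : IsCyclic K)
    (h : H ≤ K) : IsCyclic H :=
  isCyclic_of_injective (Subgroup.inclusion h) (Subgroup.inclusion_injective h)

theorem infinite_of_subgroup_le {G : Type*} [Group G] {H K : Subgroup G} (hH : Infinite H)
    (h : H ≤ K) : Infinite K :=
  Infinite.of_injective _ (Subgroup.inclusion_injective h)

namespace SimpleGraph

variable {V : Type*} {Γ : SimpleGraph V}

/-- Walks can be pushed into a side `R` of an edge. -/
theorem Walk.exists_avoiding {R : Set V} {x z : V} (hz : z ∈ R)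
    (hR : ∀ a b, Γ.Adj a b → a ∈ R → b ∉ R → a = z ∧ b = x)
    {a b : V} (p : Γ.Walk a b) (ha : a ∈ R) (hb : b ∈ R) :
    ∃ q : Γ.Walk a b, ∀ y ∈ q.support, y ∈ R := by
  classical
  obtain ⟨q, hq⟩ := p.exists_lazy_map (Δ := Γ) (fun y => if y ∈ R then y else z) (by
    intro c d hcd
    by_cases hc : c ∈ R <;> by_cases hd : d ∈ R
    · simp [hc, hd, hcd]
    · obtain ⟨rfl, -⟩ := hR c d hcd hc hd
      simp [hc, hd]
    · obtain ⟨rfl, -⟩ := hR d c hcd.symm hd hc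
      simp [hc, hd]
    · simp [hc, hd])
  refine ⟨q.copy (if_pos ha) (if_pos hb), fun y hy => ?_⟩
  rw [Walk.support_copy] at hy
  obtain ⟨w, -, rfl⟩ := hq y hy
  by_cases hw : w ∈ R <;> simp [hw, hz]

end SimpleGraph

/-! ### Minimal subtrees, gluing, and intersections of special factors -/

namespace GTree

variable {G : Type u} [Group G]

/-- A tree in which the vertex stabilizers of a cocompact tree are elliptic contains a minimal
cocompact invariant subtree. -/
theorem exists_minimal_subtree (T U : GTree G) (hT : T.IsCocompact)
    (hell : ∀ v : T.V, U.IsElliptic (T.vertexStab v)) :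
    ∃ (Z : Set U.V) (hZ : U.graph.IsSubtree Z) (hinv : ∀ (g : G), ∀ z ∈ Z, g • z ∈ Z),
      (U.restrict Z hZ hinv).IsMinimal ∧ (U.restrict Z hZ hinv).IsCocompact := by
  have hne := U.isTree.connected.nonempty
  obtain ⟨f, hf⟩ := exists_equivariantOn (G := G) (V := U.V) (Set.univ : Set T.V)
    (fun _ _ _ => trivial) (fun v _ => by
      obtain ⟨w, hw⟩ := hell v
      exact ⟨w, fun g hg => hw hg⟩)
  replace hf : ∀ (g : G) (v : T.V), f (g • v) = g • f v := fun g v => hf g v trivial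
  -- This is the geodesic from `f v` to `f w`; quantifying over all walks makes its equivariance
  -- immediate.
  let seg : T.V → T.V → Set U.V := fun v w => {z | ∀ p : U.graph.Walk (f v) (f w), z ∈ p.support}
  have hseg : ∀ (g : G) v w, ∀ z ∈ seg v w, g • z ∈ seg (g • v) (g • w) := by
    intro g v w z hz p
    obtain ⟨q, -, hq⟩ := U.exists_smul_walk g⁻¹ p
    have h1 := hz (q.copy (by rw [hf, inv_smul_smul]) (by rw [hf, inv_smul_smul]))
    rw [Walk.support_copy] at h1
    obtain ⟨y, hy, rfl⟩ := hq z h1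
    simpa using hy
  have hsegfin : ∀ v w, (seg v w).Finite := fun v w => by
    have p := (U.isTree.connected.preconnected (f v) (f w)).some
    exact (List.finite_toSet p.support).subset fun z hz => hz p
  let rel : T.V → T.V → Prop := fun v w => v = w ∨ T.graph.Adj v w
  have hrel : ∀ (g : G) v w, rel v w → rel (g • v) (g • w) := by
    rintro g v w (rfl | h)
    · exact Or.inl rfl
    · exact Or.inr (T.adj_smul g v w h)
  let Z₀ : Set U.V := {z | ∃ v w, rel v w ∧ z ∈ seg v w}
  have hfZ : ∀ v, f v ∈ Z₀ := fun v => ⟨v, v, Or.inl rfl, fun p => p.start_mem_support⟩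
  have hinv₀ : ∀ (g : G), ∀ z ∈ Z₀, g • z ∈ Z₀ := by
    rintro g z ⟨v, w, h, hz⟩
    exact ⟨_, _, hrel g v w h, hseg g v w z hz⟩
  have hsegpath : ∀ v w, rel v w → ∃ p : U.graph.Walk (f v) (f w), p.IsPath ∧
      ∀ z ∈ p.support, z ∈ Z₀ := by
    intro v w h
    obtain ⟨p, hp, -⟩ := U.isTree.existsUnique_path (f v) (f w)
    exact ⟨p, hp, fun z hz => ⟨v, w, h, fun q => U.isTree.mem_support_of_isPath hp hz q⟩⟩
  have hsub₀ : U.graph.IsSubtree Z₀ := by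
    classical
    obtain ⟨v₀⟩ := T.isTree.connected.nonempty
    have hstart : ∀ v, ∃ p : U.graph.Walk (f v₀) (f v), ∀ z ∈ p.support, z ∈ Z₀ := by
      intro v
      obtain ⟨p⟩ := T.isTree.connected.preconnected v₀ v
      induction p with
      | nil => exact ⟨Walk.nil, by simpa using hfZ _⟩
      | @cons a b c hab p ih =>
        obtain ⟨q, hq⟩ := ih
        obtain ⟨q', -, hq'⟩ := hsegpath a b (Or.inr hab)
        refine ⟨q'.append q, fun z hz => ?_⟩
        rcases (Walk.mem_support_append_iff _ _).1 hz with h | h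
        · exact hq' z h
        · exact hq z h
    have hto : ∀ z ∈ Z₀, ∃ p : U.graph.Walk (f v₀) z, ∀ y ∈ p.support, y ∈ Z₀ := by
      rintro z ⟨v, w, h, hz⟩
      obtain ⟨q, hq⟩ := hstart v
      obtain ⟨q', -, hq'⟩ := hsegpath v w h
      refine ⟨q.append (q'.takeUntil z (hz q')), fun y hy => ?_⟩
      rcases (Walk.mem_support_append_iff _ _).1 hy with h | h
      · exact hq y h
      · exact hq' y (q'.support_takeUntil_subset_support _ h)
    refine ⟨⟨f v₀, hfZ v₀⟩, fun a ha b hb => ?_⟩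
    obtain ⟨p, hp⟩ := hto a ha
    obtain ⟨q, hq⟩ := hto b hb
    refine ⟨p.reverse.append q, fun y hy => ?_⟩
    rcases (Walk.mem_support_append_iff _ _).1 hy with h | h
    · exact hp y (by simpa using h)
    · exact hq y h
  obtain ⟨⟨s₁, hs₁, hc₁⟩, s₂, hs₂, hc₂⟩ := hT
  let I : Set (T.V × T.V) := (fun v => (v, v)) '' s₁ ∪ s₂
  have hI : I.Finite := (hs₁.image _).union hs₂
  have hIc : ∀ v w, rel v w → ∃ g : G, (g • v, g • w) ∈ I := by
    rintro v w (rfl | h)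
    · obtain ⟨g, hg⟩ := hc₁ v
      exact ⟨g, Or.inl ⟨_, hg, rfl⟩⟩
    · obtain ⟨g, hg⟩ := hc₂ v w h
      exact ⟨g, Or.inr hg⟩
  let F : Set U.V := ⋃ i ∈ I, seg i.1 i.2
  have hF : F.Finite := hI.biUnion fun i _ => hsegfin i.1 i.2
  have hFc : ∀ z ∈ Z₀, ∃ g : G, g • z ∈ F := by
    rintro z ⟨v, w, h, hz⟩
    obtain ⟨g, hg⟩ := hIc v w h
    exact ⟨g, Set.mem_biUnion hg (hseg g v w z hz)⟩
  -- If no segment contained the edge `zz'`, its cut would never separate the images of adjacent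
  -- vertices. The image of `f`, and with it every segment, would lie on one side, although `z` and
  -- `z'` both lie on segments.
  have hedge : ∀ z ∈ Z₀, ∀ z' ∈ Z₀, U.graph.Adj z z' →
      ∃ v w, rel v w ∧ z ∈ seg v w ∧ z' ∈ seg v w := by
    rintro z ⟨v, w, h, hz⟩ z' ⟨v', w', h', hz'⟩ hadj
    by_contra hcon
    push Not at hcon
    obtain ⟨R, hz'R, hzR, hR⟩ := U.isTree.isAcyclic.exists_cut hadj
    have hR' : ∀ a b, U.graph.Adj a b → a ∈ Rᶜ → b ∉ Rᶜ → a = z ∧ b = z' := by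
      intro a b hab ha hb
      exact (hR b a hab.symm (not_not.1 hb) ha).symm
    have hside : ∀ a b, T.graph.Adj a b → f a ∈ R → f b ∈ R := by
      intro a b hab ha
      by_contra hb
      have hcross : ∀ p : U.graph.Walk (f a) (f b), z' ∈ p.support ∧ z ∈ p.support := by
        intro p
        obtain ⟨c, d, hcd, hc, hd, hcp, hdp⟩ := p.exists_crossing R ha hb
        obtain ⟨rfl, rfl⟩ := hR c d hcd hc hd
        exact ⟨hcp, hdp⟩
      exact hcon a b (Or.inr hab) (fun p => (hcross p).2) (fun p => (hcross p).1)
    have hconst : ∀ a b, f a ∈ R → f b ∈ R := fun a b ha =>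
      (T.isTree.connected.isSubtree_univ.subset_of_closed (R := {v | f v ∈ R}) (a := a)
        trivial ha fun x _ y _ hxy hx => hside x y hxy hx) (Set.mem_univ b)
    by_cases hv : f v ∈ R
    · obtain ⟨q, hq⟩ := (U.isTree.connected.preconnected (f v) (f w)).some.exists_avoiding
        hz'R hR hv (hconst v w hv)
      exact hzR (hq z (hz q))
    · have hv' : ∀ a, f a ∈ Rᶜ := fun a ha => hv (hconst a v ha)
      obtain ⟨q, hq⟩ := (U.isTree.connected.preconnected (f v') (f w')).some.exists_avoiding
        (show z ∈ Rᶜ from hzR) hR' (hv' v') (hv' w')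
      exact hq z' (hz' q) hz'R
  -- An invariant subset of `Z₀` is determined by its trace on the finite set `F`, so a subtree with
  -- smallest trace is minimal.
  obtain ⟨Z, ⟨hZs, hZ, hinv⟩, hmin⟩ := exists_forall_le_nat
    (fun Z : Set U.V => Z ⊆ Z₀ ∧ U.graph.IsSubtree Z ∧ ∀ (g : G), ∀ z ∈ Z, g • z ∈ Z)
    (fun Z => (Z ∩ F).ncard) ⟨Z₀, le_rfl, hsub₀, hinv₀⟩
  refine ⟨Z, hZ, hinv, U.restrict_minimal hZ hinv ?_, U.restrict_cocompact hZ hinv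
    ⟨F, hF, fun z hz => hFc z (hZs hz)⟩ ⟨⋃ i ∈ I, seg i.1 i.2 ×ˢ seg i.1 i.2,
      hI.biUnion fun i _ => (hsegfin i.1 i.2).prod (hsegfin i.1 i.2), ?_⟩⟩
  · intro Z' hZ' hsub' hinv'
    have h1 := hmin Z' ⟨hZ'.trans hZs, hsub', hinv'⟩
    have h2 : Z' ∩ F = Z ∩ F := Set.eq_of_subset_of_ncard_le (Set.inter_subset_inter_left F hZ') h1
      (hF.subset Set.inter_subset_right)
    refine hZ'.antisymm fun z hz => ?_
    obtain ⟨g, hg⟩ := hFc z (hZs hz)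
    have h3 : g • z ∈ Z' ∩ F := by
      rw [h2]
      exact ⟨hinv g z hz, hg⟩
    simpa using hinv' g⁻¹ _ h3.1
  · intro z hz z' hz' hadj
    obtain ⟨v, w, h, h1, h2⟩ := hedge z (hZs hz) z' (hZs hz') hadj
    obtain ⟨g, hg⟩ := hIc v w h
    exact ⟨g, Set.mem_biUnion hg (Set.mk_mem_prod (hseg g v w z h1) (hseg g v w z' h2))⟩

/-- The graph obtained from `P` by replacing every vertex by a copy of `Q`; the edge `xy` is attached
at the points `att x y` and `att y x`. -/
def glueGraph (P Q : GTree G) (att : P.V → P.V → Q.V) : SimpleGraph (P.V × Q.V) where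
  Adj a b := (a.1 = b.1 ∧ Q.graph.Adj a.2 b.2) ∨
    (P.graph.Adj a.1 b.1 ∧ a.2 = att a.1 b.1 ∧ b.2 = att b.1 a.1)
  symm := ⟨fun a b h => by
    rcases h with ⟨h1, h2⟩ | ⟨h1, h2, h3⟩
    · exact Or.inl ⟨h1.symm, h2.symm⟩
    · exact Or.inr ⟨h1.symm, h3, h2⟩⟩
  loopless := ⟨fun a h => by
    rcases h with ⟨-, h⟩ | ⟨h, -⟩
    · exact h.ne rfl
    · exact h.ne rfl⟩

/-- The tree obtained from `P` by replacing every vertex by a copy of `Q`. -/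
def glue (P Q : GTree G) (att : P.V → P.V → Q.V)
    (hatt : ∀ (g : G) x y, P.graph.Adj x y → att (g • x) (g • y) = g • att x y) : GTree G where
  V := P.V × Q.V
  graph := glueGraph P Q att
  isTree := by
    set Γ : SimpleGraph (P.V × Q.V) := glueGraph P Q att
    have hfib : ∀ x (m n : Q.V), Γ.Reachable (x, m) (x, n) := fun x m n => by
      obtain ⟨q, -⟩ := (Q.isTree.connected.preconnected m n).some.exists_lazy_map (Δ := Γ)
        (fun k => (x, k)) (fun a b hab => Or.inr (Or.inl ⟨rfl, hab⟩))
      exact ⟨q⟩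
    refine (isTree_iff _).2 ⟨?_, isAcyclic_of_cuts ?_⟩
    · have := P.isTree.connected.nonempty
      have := Q.isTree.connected.nonempty
      have : Nonempty (P.V × Q.V) := inferInstance
      refine ⟨?_⟩
      rintro ⟨x, m⟩ ⟨y, n⟩
      obtain ⟨p⟩ := P.isTree.connected.preconnected x y
      induction p generalizing m with
      | nil => exact hfib _ m n
      | @cons a b c hab p ih =>
        have h1 : Γ.Adj (a, att a b) (b, att b a) := Or.inr ⟨hab, rfl, rfl⟩
        exact ((hfib a m _).trans h1.reachable).trans (ih _)
    · have hcut := fun x z (h : P.graph.Adj x z) => P.isTree.isAcyclic.exists_cut h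
      choose side hs1 hs2 hs3 using hcut
      rintro ⟨x, m⟩ ⟨x', m'⟩ (⟨h1, h2⟩ | ⟨h1, h2, h3⟩)
      · obtain rfl : x = x' := h1
        obtain ⟨R, hm', hm, hR⟩ := Q.isTree.isAcyclic.exists_cut h2
        -- For an edge inside the copy of `Q` over `x`, the cut consists of one side `R` of the edge
        -- in that copy and of everything over the components of `P` minus `x` attached at points of
        -- `R`.
        refine ⟨{a | (a.1 = x ∧ a.2 ∈ R) ∨ (a.1 ≠ x ∧ ∃ z, ∃ h : P.graph.Adj x z,
          a.1 ∈ side x z h ∧ att x z ∈ R)}, Or.inl ⟨rfl, hm'⟩, ?_, ?_⟩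
        · rintro (⟨-, h⟩ | ⟨h, -⟩)
          · exact hm h
          · exact h rfl
        · rintro ⟨y, n⟩ ⟨y', n'⟩ (⟨hy, hn⟩ | ⟨hy, hn, hn'⟩) ha hb
          · obtain rfl : y = y' := hy
            rcases ha with ⟨rfl, ha⟩ | ha
            · obtain ⟨h3, h4⟩ := hR n n' hn ha (fun h => hb (Or.inl ⟨rfl, h⟩))
              exact ⟨Prod.ext rfl h3, Prod.ext rfl h4⟩
            · exact absurd (Or.inr ha) hb
          · exfalso
            rcases ha with ⟨hyx, ha⟩ | ⟨hyx, z, hxz, hz, hzR⟩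
            · dsimp only at hyx hn hn' ha hy
              subst hyx
              exact hb (Or.inr ⟨hy.ne', y', hy, hs1 _ _ hy, hn ▸ ha⟩)
            · dsimp only at hyx hn hn' hz hy
              by_cases hy'x : y' = x
              · subst hy'x
                obtain ⟨rfl, -⟩ := hs3 _ _ hxz _ _ hy hz (hs2 _ _ hxz)
                exact hb (Or.inl ⟨rfl, by rw [hn']; exact hzR⟩)
              · refine hb (Or.inr ⟨hy'x, z, hxz, ?_, hzR⟩)
                by_contra hcon
                exact hy'x (hs3 _ _ hxz _ _ hy hz hcon).2
      · refine ⟨{a | a.1 ∈ side x x' h1}, hs1 _ _ h1, hs2 _ _ h1, ?_⟩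
        rintro ⟨y, n⟩ ⟨y', n'⟩ (⟨hy, hn⟩ | ⟨hy, hn, hn'⟩) ha hb
        · obtain rfl : y = y' := hy
          exact absurd ha hb
        · obtain ⟨h4, h5⟩ := hs3 _ _ h1 y y' hy ha hb
          dsimp only at h1 h2 h3 h4 h5 hy hn hn'
          subst h4 h5
          exact ⟨Prod.ext rfl (hn.trans h3.symm), Prod.ext rfl (hn'.trans h2.symm)⟩
  adj_smul := by
    rintro g a b (⟨h1, h2⟩ | ⟨h1, h2, h3⟩)
    · exact Or.inl ⟨congrArg (g • ·) h1, Q.adj_smul g _ _ h2⟩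
    · refine Or.inr ⟨P.adj_smul g _ _ h1, ?_, ?_⟩
      · exact (congrArg (g • ·) h2).trans (hatt g _ _ h1).symm
      · exact (congrArg (g • ·) h3).trans (hatt g _ _ h1.symm).symm
  no_inversion := by
    rintro g a b (⟨h1, h2⟩ | ⟨h1, -⟩) ⟨h3, h4⟩
    · exact Q.no_inversion g _ _ h2 ⟨congrArg Prod.snd h3, congrArg Prod.snd h4⟩
    · exact P.no_inversion g _ _ h1 ⟨congrArg Prod.fst h3, congrArg Prod.fst h4⟩

/-- The lift of an edge is unique: the fibres over its ends are connected and lie on opposite sides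
of any lift. Uniqueness gives equality of stabilizers, hence of allowed edge groups. -/
theorem IsCollapse.exists_lift {S S' : GTree G} {c : S.V → S'.V} (hc : IsCollapse S S' c)
    {x y : S'.V} (hxy : S'.graph.Adj x y) :
    ∃ s t, S.graph.Adj s t ∧ c s = x ∧ c t = y ∧ S'.edgeStab x y = S.edgeStab s t := by
  obtain ⟨R, hy, hx, hR⟩ := S'.isTree.isAcyclic.exists_cut hxy
  obtain ⟨x₀, rfl⟩ := hc.surjective x
  obtain ⟨y₀, rfl⟩ := hc.surjective y
  obtain ⟨t, s, hts, ht, hs, -, -⟩ :=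
    (S.isTree.connected.preconnected y₀ x₀).some.exists_crossing (c ⁻¹' R) hy hx
  have hadj : S'.graph.Adj (c t) (c s) :=
    (hc.edge t s hts).resolve_left (fun h => hs (by
      change c s ∈ R
      rw [← h]
      exact ht))
  obtain ⟨h1, h2⟩ := hR _ _ hadj ht hs
  refine ⟨s, t, hts.symm, h2, h1, ?_⟩
  have huniq : ∀ s' t', S.graph.Adj s' t' → c s' = c x₀ → c t' = c y₀ → s' = s ∧ t' = t := by
    intro s' t' hst hs' ht'
    obtain ⟨R', htR, hsR, hR'⟩ := S.isTree.isAcyclic.exists_cut hts.symm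
    have hne : c x₀ ≠ c y₀ := hxy.ne
    have hR'c : ∀ a b, S.graph.Adj a b → a ∈ R'ᶜ → b ∉ R'ᶜ → a = s ∧ b = t := by
      intro a b hab ha hb
      exact (hR' b a hab.symm (not_not.1 hb) ha).symm
    have ht'R : t' ∈ R' := (isSubtree_iff.2 (hc.fibre (c y₀))).subset_of_closed h1 htR
      (fun a ha b hb hab haR => by
        by_contra hbR
        obtain ⟨-, rfl⟩ := hR' a b hab haR hbR
        exact hne (h2.symm.trans hb)) ht'
    have hs'R : s' ∈ R'ᶜ := (isSubtree_iff.2 (hc.fibre (c x₀))).subset_of_closed h2 hsR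
      (fun a ha b hb hab haR => by
        by_contra hbR
        obtain ⟨-, rfl⟩ := hR'c a b hab haR hbR
        exact hne (Eq.trans (Eq.symm hb) h1)) hs'
    exact (hR' t' s' hst.symm ht'R hs'R).symm
  ext g
  rw [mem_edgeStab, mem_edgeStab]
  constructor
  · rintro ⟨hg1, hg2⟩
    exact huniq _ _ (S.adj_smul g _ _ hts.symm) (by rw [hc.equivariant, h2, hg1])
      (by rw [hc.equivariant, h1, hg2])
  · rintro ⟨hg1, hg2⟩
    rw [← h1, ← h2, ← hc.equivariant, ← hc.equivariant, hg1, hg2]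
    exact ⟨rfl, rfl⟩

theorem IsCollapse.vertexStab_le {S S' : GTree G} {c : S.V → S'.V} (hc : IsCollapse S S' c)
    (s : S.V) : S.vertexStab s ≤ S'.vertexStab (c s) := fun g hg => by
  rw [mem_vertexStab, ← hc.equivariant, mem_vertexStab.1 hg]

theorem IsBlock.restrict {S : GTree G} {Y : Set S.V} {B : Subgroup G} (hY : S.IsBlock Y B)
    {Z : Set S.V} (hZ : S.graph.IsSubtree Z) (hinv : ∀ (g : G), ∀ z ∈ Z, g • z ∈ Z)
    (hne : (Y ∩ Z).Nonempty) :
    (S.restrict Z hZ hinv).IsBlock {z : Z | z.1 ∈ Y} B where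
  subtree := by
    have h := (hY.subtree.inter S.isTree hZ hne).preimage_val (Set.inter_subset_right)
    rwa [show (Subtype.val ⁻¹' (Y ∩ Z) : Set Z) = {z : Z | z.1 ∈ Y} from
      Set.ext fun z => ⟨fun h => h.1, fun h => ⟨h, z.2⟩⟩] at h
  smul_mem g hg y hy := hY.smul_mem g hg y.1 hy
  mem_of g y hy hgy := hY.mem_of g y.1 hy hgy

theorem glue_isSubtree {P Q : GTree G} {att : P.V → P.V → Q.V}
    (hatt : ∀ (g : G) x y, P.graph.Adj x y → att (g • x) (g • y) = g • att x y) {Y : Set Q.V}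
    (hY : Q.graph.IsSubtree Y) (x : P.V) :
    (glue P Q att hatt).graph.IsSubtree {a : P.V × Q.V | a.1 = x ∧ a.2 ∈ Y} := by
  obtain ⟨y, hy⟩ := hY.1
  refine ⟨⟨(x, y), rfl, hy⟩, ?_⟩
  rintro ⟨_, m⟩ ⟨rfl, hm⟩ ⟨x', n⟩ ⟨hx', hn⟩
  dsimp only at hx' hm hn
  subst hx'
  obtain ⟨p, hp⟩ := hY.2 m hm n hn
  obtain ⟨q, hq⟩ := p.exists_lazy_map (Δ := (glue P Q att hatt).graph)
    (fun k => (x', k)) (fun a b hab => Or.inr (Or.inl ⟨rfl, hab⟩))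
  refine ⟨q, fun z hz => ?_⟩
  obtain ⟨w, hw, rfl⟩ := hq z hz
  exact ⟨rfl, hp w hw⟩

/-- Two special factors containing a common loxodromic element have a special factor as
intersection; moreover some tree has nested blocks for one of them and the intersection. -/
theorem exists_nested_blocks {T : GTree G} (hT : T.IsGBSTree) {𝓐 : Set (Subgroup G)}
    (h𝓐 : ∀ H ∈ 𝓐, ∀ K : Subgroup G, K ≤ H → K ∈ 𝓐) {A B : Subgroup G}
    (hA : T.IsSpecialFactor 𝓐 A) (hB : T.IsSpecialFactor 𝓐 B) {h : G} (hh : T.IsLoxodromic h)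
    (hhA : h ∈ A) (hhB : h ∈ B) :
    ∃ S ∈ T.restrictedSpace 𝓐, ∃ Y Y' : Set S.V, S.IsBlock Y A ∧ S.IsBlock Y' (A ⊓ B) ∧
      Y' ⊆ Y := by
  obtain ⟨-, S₁, hS₁, P, c, hc, x₀, rfl⟩ := hA
  obtain ⟨-, Q, hQ, Y₂, hY₂⟩ := isSpecialFactor_iff.1 hB
  have hQne := Q.isTree.connected.nonempty
  -- Edge stabilizers of `P` are edge stabilizers of `S₁`, hence elliptic in `Q`; each fixes a
  -- vertex at which the edge can be attached.
  obtain ⟨f, hf⟩ := exists_equivariantOn (G := G) (V := Q.V)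
    {e : P.V × P.V | P.graph.Adj e.1 e.2} (fun g e he => P.adj_smul g _ _ he) (by
      rintro ⟨x, y⟩ hxy
      obtain ⟨s, t, -, -, -, hst⟩ := hc.exists_lift hxy
      obtain ⟨w, hw⟩ := (hQ.1.2 _).2 ((hS₁.1.2 _).1
        ((S₁.isElliptic_vertexStab s).mono (inf_le_left : S₁.edgeStab s t ≤ _)))
      refine ⟨w, fun g hg => hw ?_⟩
      change g ∈ S₁.edgeStab s t
      rw [← hst, mem_edgeStab]
      exact ⟨congrArg Prod.fst hg, congrArg Prod.snd hg⟩)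
  have hatt : ∀ (g : G) x y, P.graph.Adj x y → f (g • x, g • y) = g • f (x, y) :=
    fun g x y hxy => hf g (x, y) hxy
  set U := glue P Q (fun x y => f (x, y)) hatt with hU
  have hstab : ∀ u : P.V × Q.V, U.vertexStab u = P.vertexStab u.1 ⊓ Q.vertexStab u.2 := by
    intro u
    ext g
    exact ⟨fun hg => ⟨congrArg Prod.fst hg, congrArg Prod.snd hg⟩,
      fun hg => Prod.ext hg.1 hg.2⟩
  have hellU : ∀ H : Subgroup G, T.IsElliptic H → U.IsElliptic H := by
    intro H hH
    obtain ⟨s, hs⟩ := (hS₁.1.2 H).2 hH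
    obtain ⟨m, hm⟩ := (hQ.1.2 H).2 hH
    refine ⟨((c s, m) : P.V × Q.V), ?_⟩
    rw [hstab]
    exact le_inf (hs.trans (hc.vertexStab_le s)) hm
  have hlox : U.IsLoxodromic h := by
    rintro ⟨x, m⟩ hx
    exact (isLoxodromic_congr hQ.1.2).2 hh m (congrArg Prod.snd hx)
  obtain ⟨Z, hZ, hinv, hmin, hcoc⟩ := T.exists_minimal_subtree U hT.cocompact
    (fun v => hellU _ (T.isElliptic_vertexStab v))
  set S := U.restrict Z hZ hinv with hSdef
  have hcomm : ∀ (s : S₁.V) (m : Q.V),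
      Subgroup.Commensurable (S₁.vertexStab s) (Q.vertexStab m) :=
    commensurable_of_mem hS₁.1 hQ.1
  have hmemS : ∀ (z : Z) (g : G),
      g ∈ S.vertexStab z ↔ g ∈ P.vertexStab z.1.1 ∧ g ∈ Q.vertexStab z.1.2 := fun z g =>
    ⟨fun hg => ⟨congrArg (fun w : Z => w.1.1) hg, congrArg (fun w : Z => w.1.2) hg⟩,
      fun hg => Subtype.ext (Prod.ext hg.1 hg.2)⟩
  have hinf : ∀ (x : P.V) (H : Subgroup G) (m : Q.V), Subgroup.Commensurable (Q.vertexStab m) H →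
      Infinite ((P.vertexStab x ⊓ H : Subgroup G)) := by
    intro x H m hH
    obtain ⟨s, rfl⟩ := hc.surjective x
    have h1 := commensurable_inf_left ((hcomm s m).trans hH)
    exact infinite_of_subgroup_le (infinite_of_commensurable h1 (hS₁.1.1.vertex_cyclic s).2)
      (inf_le_inf_right _ (hc.vertexStab_le s))
  -- Edges inside a copy of `Q` have stabilizers contained in edge groups of `Q`, where closure of
  -- `𝓐` under subgroups is needed. Edges coming from `P` keep the edge groups of `S₁`, since these
  -- fix the attaching points.
  have hedge : ∀ z w : Z, S.graph.Adj z w → S.edgeStab z w ∈ 𝓐 ∧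
      IsInfiniteCyclic (S.edgeStab z w) := by
    rintro z w (⟨h1, h2⟩ | ⟨h1, h2, h3⟩)
    · replace h1 : z.1.1 = w.1.1 := h1
      replace h2 : Q.graph.Adj z.1.2 w.1.2 := h2
      have he : S.edgeStab z w = P.vertexStab z.1.1 ⊓ Q.edgeStab z.1.2 w.1.2 :=
        Subgroup.ext fun g => ⟨fun hg => ⟨((hmemS z g).1 hg.1).1, ((hmemS z g).1 hg.1).2,
          ((hmemS w g).1 hg.2).2⟩, fun hg => ⟨(hmemS z g).2 ⟨hg.1, hg.2.1⟩,
            (hmemS w g).2 ⟨h1 ▸ hg.1, hg.2.2⟩⟩⟩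
      rw [he]
      have hcyc := hQ.1.1.edge_cyclic _ _ h2
      refine ⟨h𝓐 _ (hQ.2 _ _ h2) _ inf_le_right, isCyclic_of_subgroup_le hcyc.1 inf_le_right,
        hinf _ _ z.1.2 ?_⟩
      exact (commensurable_of_le inf_le_left (relIndex_ne_zero_of_isCyclic
        (hQ.1.1.vertex_cyclic _).1 inf_le_left hcyc.2)).symm
    · replace h1 : P.graph.Adj z.1.1 w.1.1 := h1
      replace h2 : z.1.2 = f (z.1.1, w.1.1) := h2
      replace h3 : w.1.2 = f (w.1.1, z.1.1) := h3
      obtain ⟨s, t, hst, -, -, he'⟩ := hc.exists_lift h1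
      have he : S.edgeStab z w = S₁.edgeStab s t := by
        rw [← he']
        refine Subgroup.ext fun g => ⟨fun hg => ⟨((hmemS z g).1 hg.1).1, ((hmemS w g).1 hg.2).1⟩,
          fun ⟨hg1, hg2⟩ => ⟨(hmemS z g).2 ⟨hg1, ?_⟩, (hmemS w g).2 ⟨hg2, ?_⟩⟩⟩
        · have := hatt g _ _ h1
          rw [mem_vertexStab.1 hg1, mem_vertexStab.1 hg2, ← h2] at this
          exact this.symm
        · have := hatt g _ _ h1.symm
          rw [mem_vertexStab.1 hg1, mem_vertexStab.1 hg2, ← h3] at this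
          exact this.symm
      rw [he]
      exact ⟨hS₁.2 s t hst, hS₁.1.1.edge_cyclic s t hst⟩
  have hS : S ∈ T.restrictedSpace 𝓐 := by
    refine ⟨⟨⟨hmin, hcoc, fun z => ?_, fun z w hzw => (hedge z w hzw).2⟩, fun H => ⟨?_, ?_⟩⟩,
      fun z w hzw => (hedge z w hzw).1⟩
    · have hz : S.vertexStab z = P.vertexStab z.1.1 ⊓ Q.vertexStab z.1.2 :=
        Subgroup.ext (hmemS z)
      rw [hz]
      exact ⟨isCyclic_of_subgroup_le (hQ.1.1.vertex_cyclic z.1.2).1 inf_le_right,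
        hinf _ _ z.1.2 (Subgroup.Commensurable.refl _)⟩
    · rintro ⟨z, hz⟩
      exact (hQ.1.2 H).1 ⟨z.1.2, fun g hg => ((hmemS z g).1 (hz hg)).2⟩
    · intro hH
      obtain ⟨z, hz, hHz⟩ := U.exists_fixed_mem hZ (fun g _ => hinv g) (hellU H hH)
      exact ⟨⟨z, hz⟩, fun g hg => Subtype.ext (hHz hg)⟩
  -- The whole copy of `Q` over `x₀` is a block for `A`, and the copy of `Y₂` inside it is a block
  -- for `A ⊓ B`. Both meet `Z` because `h` is loxodromic and preserves all three subtrees.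
  have hYA : U.IsBlock {a : P.V × Q.V | a.1 = x₀ ∧ a.2 ∈ (Set.univ : Set Q.V)} (P.vertexStab x₀) :=
    { subtree := glue_isSubtree hatt Q.isTree.connected.isSubtree_univ x₀
      smul_mem := by
        rintro g hg ⟨x, m⟩ ⟨hx, -⟩
        dsimp only at hx
        subst hx
        exact ⟨hg, trivial⟩
      mem_of := by
        rintro g ⟨x, m⟩ ⟨hx, -⟩ ⟨hgx, -⟩
        dsimp only at hx
        subst hx
        exact hgx }
  have hYB : U.IsBlock {a : P.V × Q.V | a.1 = x₀ ∧ a.2 ∈ Y₂} (P.vertexStab x₀ ⊓ B) :=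
    { subtree := glue_isSubtree hatt hY₂.subtree x₀
      smul_mem := by
        rintro g ⟨hg, hgB⟩ ⟨x, m⟩ ⟨hx, hm⟩
        dsimp only at hx
        subst hx
        exact ⟨hg, hY₂.smul_mem g hgB m hm⟩
      mem_of := by
        rintro g ⟨x, m⟩ ⟨hx, hm⟩ ⟨hgx, hgm⟩
        dsimp only at hx
        subst hx
        exact ⟨hgx, hY₂.mem_of g m hm hgm⟩ }
  have hne := U.inter_nonempty_of_loxodromic hYB.subtree hZ hlox
    (hYB.smul_mem_iff ⟨hhA, hhB⟩) (fun y => ⟨fun hy => by simpa using hinv h⁻¹ _ hy, hinv h y⟩)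
  have hne' := hne.mono (Set.inter_subset_inter_left Z
    (fun a (ha : a.1 = x₀ ∧ a.2 ∈ Y₂) => (⟨ha.1, trivial⟩ : a.1 = x₀ ∧ a.2 ∈ Set.univ)))
  exact ⟨S, hS, _, _, hYA.restrict hZ hinv hne', hYB.restrict hZ hinv hne,
    fun a ha => ⟨ha.1, trivial⟩⟩

/-! ### Homomorphisms vanishing on elliptic elements -/

/-- Homomorphisms from `B` to `ℝ` which vanish on elliptic elements. -/
def ellipticHoms (T : GTree G) (B : Subgroup G) : Submodule ℝ (B → ℝ) where
  carrier := {χ | (∀ a b, χ (a * b) = χ a + χ b) ∧ ∀ b : B, ¬ T.IsLoxodromic b.1 → χ b = 0}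
  zero_mem' := ⟨fun _ _ => (add_zero (0 : ℝ)).symm, fun _ _ => rfl⟩
  add_mem' := by
    rintro χ ψ ⟨h1, h2⟩ ⟨h3, h4⟩
    refine ⟨fun a b => ?_, fun b hb => ?_⟩
    · simp only [Pi.add_apply, h1, h3]
      ring
    · simp only [Pi.add_apply, h2 b hb, h4 b hb, add_zero]
  smul_mem' := by
    rintro r χ ⟨h1, h2⟩
    refine ⟨fun a b => ?_, fun b hb => ?_⟩
    · simp only [Pi.smul_apply, h1, smul_add]
    · simp only [Pi.smul_apply, h2 b hb, smul_zero]

/-- Restriction of homomorphisms. -/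
def restrictHoms (T : GTree G) {D B : Subgroup G} (h : D ≤ B) :
    T.ellipticHoms B →ₗ[ℝ] T.ellipticHoms D where
  toFun χ := ⟨fun d => χ.1 (Subgroup.inclusion h d),
    fun a b => χ.2.1 (Subgroup.inclusion h a) (Subgroup.inclusion h b), fun _ hb => χ.2.2 _ hb⟩
  map_add' _ _ := rfl
  map_smul' _ _ := rfl

/-- The periods of an invariant cochain. -/
theorem exists_hom_of_potential {T S : GTree G}
    (hlox : ∀ g : G, S.IsLoxodromic g ↔ T.IsLoxodromic g) (B : Subgroup G) (c : S.V → S.V → ℝ)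
    (hinv : ∀ b ∈ B, ∀ x y, S.graph.Adj x y → c (b • x) (b • y) = c x y) {p : S.V → ℝ}
    (hp : ∀ x y, S.graph.Adj x y → p y - p x = c x y) :
    ∃ χ : T.ellipticHoms B, ∀ (b : B) (x : S.V), p (b.1 • x) - p x = χ.1 b := by
  obtain ⟨x₀⟩ := S.isTree.connected.nonempty
  have hconst : ∀ b ∈ B, ∀ x, p (b • x) - p x = p (b • x₀) - p x₀ := fun b hb x =>
    S.isTree.connected.isSubtree_univ.constant (fun x => p (b • x) - p x)
      (fun x _ y _ hxy => by
        have h1 := hp x y hxy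
        have h2 := hp _ _ (S.adj_smul b x y hxy)
        rw [hinv b hb x y hxy] at h2
        linarith) trivial trivial
  refine ⟨⟨fun b => p (b.1 • x₀) - p x₀, fun a b => ?_, fun b hb => ?_⟩,
    fun b x => hconst b.1 b.2 x⟩
  · have h1 := hconst a.1 a.2 (b.1 • x₀)
    change p ((a.1 * b.1) • x₀) - p x₀ = (p (a.1 • x₀) - p x₀) + (p (b.1 • x₀) - p x₀)
    rw [mul_smul]
    linarith
  · rw [← hlox] at hb
    simp only [IsLoxodromic, not_forall, not_not, ne_eq] at hb
    obtain ⟨v, hv⟩ := hb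
    change p (b.1 • x₀) - p x₀ = 0
    rw [← hconst b.1 b.2 v, hv, sub_self]

/-- The periods of a potential of `c` form a homomorphism on `B`. It vanishes on `D` since `c`
vanishes on `Y`, so injectivity of restriction makes it zero. -/
theorem exists_invariant_potential {T S : GTree G}
    (hlox : ∀ g : G, S.IsLoxodromic g ↔ T.IsLoxodromic g) {D B : Subgroup G} (hDB : D ≤ B)
    (hinj : Function.Injective (T.restrictHoms hDB)) {Y : Set S.V} (hY : S.graph.IsSubtree Y)
    (hDY : ∀ d ∈ D, ∀ y ∈ Y, d • y ∈ Y) (c : S.V → S.V → ℝ)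
    (hanti : ∀ x y, S.graph.Adj x y → c y x = - c x y)
    (hinv : ∀ b ∈ B, ∀ x y, S.graph.Adj x y → c (b • x) (b • y) = c x y)
    (hzero : ∀ x ∈ Y, ∀ y ∈ Y, S.graph.Adj x y → c x y = 0) :
    ∃ p : S.V → ℝ, (∀ x y, S.graph.Adj x y → p y - p x = c x y) ∧
      ∀ b ∈ B, ∀ x, p (b • x) = p x := by
  obtain ⟨p, hp⟩ := S.isTree.exists_potential c hanti
  obtain ⟨χ, hχ⟩ := exists_hom_of_potential hlox B c hinv hp
  have h0 : χ = 0 := by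
    apply hinj
    rw [map_zero]
    apply Subtype.ext
    funext d
    obtain ⟨y, hy⟩ := hY.1
    have h1 : p y = p (d.1 • y) := hY.constant p (fun x hx z hz hxz => by
      have := hp x z hxz
      rw [hzero x hx z hz hxz] at this
      linarith) hy (hDY d.1 d.2 y hy)
    have h2 := hχ ⟨d.1, hDB d.2⟩ y
    change χ.1 ⟨d.1, hDB d.2⟩ = 0
    rw [← h2, ← h1, sub_self]
  refine ⟨p, hp, fun b hb x => ?_⟩
  have := hχ ⟨b, hb⟩ x
  rw [h0] at this
  exact sub_eq_zero.1 this

/-- The elements `σ (d • v)` and `d * σ v` differ by one fixing the orbit representative, which `χ`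
does not see. Thus `χ ∘ σ` is a function on vertices with period homomorphism `χ`. -/
theorem exists_hom_section (T S : GTree G)
    (hlox : ∀ g : G, S.IsLoxodromic g ↔ T.IsLoxodromic g) (D : Subgroup G) :
    ∃ σ : S.V → D, ∀ χ ∈ T.ellipticHoms D, ∀ (d : D) (v : S.V),
      χ (σ (d.1 • v)) = χ d + χ (σ v) := by
  obtain ⟨r, σ, -, -, h⟩ := exists_orbit_section D S.V
  refine ⟨σ, fun χ hχ d v => ?_⟩
  have h1 := hχ.2 ((σ (d • v))⁻¹ * (d * σ v)) (fun hl => (hlox _).2 hl _ (h d v))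
  have h2 := hχ.1 (σ (d • v)) ((σ (d • v))⁻¹ * (d * σ v))
  rw [mul_inv_cancel_left, h1, add_zero, hχ.1] at h2
  exact h2.symm

/-- To extend `χ` from `D` to `B`, take a function on vertices with periods `χ`, spread its
differential from `Y` over the `B`-translates of `Y`, put zero on other edges, and integrate. The
periods of the result extend `χ`. The spreading is well defined because overlapping translates of
`Y` differ by `D`. -/
theorem IsBlock.restrictHoms_surjective {T S : GTree G}
    (hlox : ∀ g : G, S.IsLoxodromic g ↔ T.IsLoxodromic g) {D B : Subgroup G} (hDB : D ≤ B)
    {Y : Set S.V} (hY : S.IsBlock Y D) : Function.Surjective (T.restrictHoms hDB) := by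
  classical
  intro χ
  obtain ⟨σ, hσ⟩ := exists_hom_section T S hlox D
  set p : S.V → ℝ := fun v => χ.1 (σ v) with hpdef
  have hp : ∀ (d : D) (v : S.V), p (d.1 • v) = χ.1 d + p v := hσ χ.1 χ.2
  let P : S.V → S.V → G → Prop := fun x y b => b ∈ B ∧ b • x ∈ Y ∧ b • y ∈ Y
  let c : S.V → S.V → ℝ := fun x y =>
    if h : ∃ b, P x y b then p (h.choose • y) - p (h.choose • x) else 0
  have hc : ∀ x y b, P x y b → c x y = p (b • y) - p (b • x) := by
    rintro x y b ⟨hb, hx, hy⟩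
    have h : ∃ b, P x y b := ⟨b, hb, hx, hy⟩
    have hc' : c x y = p (h.choose • y) - p (h.choose • x) := dif_pos h
    obtain ⟨hb', hx', hy'⟩ := h.choose_spec
    have hd : h.choose * b⁻¹ ∈ D := hY.mem_of _ _ hx (by rwa [mul_smul, inv_smul_smul])
    have h1 := hp ⟨_, hd⟩ (b • x)
    have h2 := hp ⟨_, hd⟩ (b • y)
    simp only [mul_smul, inv_smul_smul] at h1 h2
    rw [hc', h1, h2]
    ring
  have hc0 : ∀ x y, (¬ ∃ b, P x y b) → c x y = 0 := fun x y h => dif_neg h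
  have hanti : ∀ x y, c y x = - c x y := by
    intro x y
    by_cases h : ∃ b, P x y b
    · obtain ⟨b, hb⟩ := h
      rw [hc x y b hb, hc y x b ⟨hb.1, hb.2.2, hb.2.1⟩]
      ring
    · rw [hc0 x y h, hc0 y x (fun ⟨b, hb⟩ => h ⟨b, hb.1, hb.2.2, hb.2.1⟩), neg_zero]
  have hinv : ∀ b ∈ B, ∀ x y, c (b • x) (b • y) = c x y := by
    intro b hb x y
    by_cases h : ∃ a, P x y a
    · obtain ⟨a, ha⟩ := h
      rw [hc x y a ha, hc (b • x) (b • y) (a * b⁻¹) ⟨B.mul_mem ha.1 (B.inv_mem hb),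
        by simpa [mul_smul] using ha.2.1, by simpa [mul_smul] using ha.2.2⟩]
      simp [mul_smul]
    · rw [hc0 x y h, hc0]
      rintro ⟨a, ha⟩
      exact h ⟨a * b, B.mul_mem ha.1 hb, by simpa [mul_smul] using ha.2.1,
        by simpa [mul_smul] using ha.2.2⟩
  obtain ⟨q, hq⟩ := S.isTree.exists_potential c (fun x y _ => hanti x y)
  obtain ⟨ψ, hψ⟩ := exists_hom_of_potential hlox B c (fun b hb x y _ => hinv b hb x y) hq
  refine ⟨ψ, Subtype.ext (funext fun d => ?_)⟩
  obtain ⟨y, hy⟩ := hY.subtree.1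
  have h1 : q y - p y = q (d.1 • y) - p (d.1 • y) := hY.subtree.constant (fun x => q x - p x)
    (fun x hx z hz hxz => by
      have h2 := hq x z hxz
      rw [hc x z 1 ⟨B.one_mem, by simpa using hx, by simpa using hz⟩, one_smul, one_smul] at h2
      linarith) hy (hY.smul_mem _ d.2 _ hy)
  have h2 := hψ ⟨d.1, hDB d.2⟩ y
  have h3 := hp d y
  change ψ.1 ⟨d.1, hDB d.2⟩ = χ.1 d
  dsimp only at h2
  linarith

theorem finite_ellipticHoms_top (T : GTree G) (hT : T.IsCocompact) :
    Module.Finite ℝ (T.ellipticHoms ⊤) := by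
  obtain ⟨σ, hσ⟩ := exists_hom_section T T (fun _ => Iff.rfl) ⊤
  obtain ⟨-, s, hs, hc⟩ := hT
  have := hs.to_subtype
  -- A homomorphism is determined by the differences of `χ ∘ σ` along representatives of the
  -- finitely many edge orbits.
  let L : T.ellipticHoms ⊤ →ₗ[ℝ] (s → ℝ) :=
    { toFun := fun χ e => χ.1 (σ e.1.2) - χ.1 (σ e.1.1)
      map_add' := fun χ ψ => by
        funext e
        change (χ.1 _ + ψ.1 _) - (χ.1 _ + ψ.1 _) = (χ.1 _ - χ.1 _) + (ψ.1 _ - ψ.1 _)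
        ring
      map_smul' := fun r χ => by
        funext e
        change r * χ.1 _ - r * χ.1 _ = r * (χ.1 _ - χ.1 _)
        ring }
  refine Module.Finite.of_injective L (LinearMap.ker_eq_bot.1 (LinearMap.ker_eq_bot'.2 ?_))
  intro χ hχ
  have hχ' := hσ χ.1 χ.2
  have hedge : ∀ x y, T.graph.Adj x y → χ.1 (σ x) = χ.1 (σ y) := by
    intro x y hxy
    obtain ⟨g, hg⟩ := hc x y hxy
    have h1 : χ.1 (σ (g • y)) - χ.1 (σ (g • x)) = 0 := congrFun hχ ⟨_, hg⟩
    have h2 := hχ' ⟨g, trivial⟩ x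
    have h3 := hχ' ⟨g, trivial⟩ y
    dsimp only at h2 h3
    linarith
  apply Subtype.ext
  funext g
  obtain ⟨v⟩ := T.isTree.connected.nonempty
  have h1 := T.isTree.connected.isSubtree_univ.constant (fun x => χ.1 (σ x))
    (fun x _ y _ hxy => hedge x y hxy) (Set.mem_univ (g.1 • v)) (Set.mem_univ v)
  have h2 := hχ' g v
  change χ.1 g = 0
  linarith

/-- A special factor containing `h` such that elliptic-trivial homomorphisms on it are determined
by their restriction to any smaller special factor containing `h`. -/
theorem exists_rigid_specialFactor {T : GTree G} (hT : T.IsGBSTree) {𝓐 : Set (Subgroup G)} {h : G}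
    (hex : ∃ B, T.IsSpecialFactor 𝓐 B ∧ h ∈ B) :
    ∃ B, (T.IsSpecialFactor 𝓐 B ∧ h ∈ B) ∧ ∀ D, T.IsSpecialFactor 𝓐 D → h ∈ D → ∀ hDB : D ≤ B,
      Function.Injective (T.restrictHoms hDB) := by
  have hfin := T.finite_ellipticHoms_top hT.cocompact
  have hsurj : ∀ D, T.IsSpecialFactor 𝓐 D → ∀ B (hDB : D ≤ B),
      Function.Surjective (T.restrictHoms hDB) := by
    intro D hD B hDB
    obtain ⟨-, S, hS, Y, hY⟩ := isSpecialFactor_iff.1 hD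
    exact hY.restrictHoms_surjective (fun g => isLoxodromic_congr hS.1.2) hDB
  have hfin' : ∀ D, T.IsSpecialFactor 𝓐 D → Module.Finite ℝ (T.ellipticHoms D) := fun D hD =>
    Module.Finite.of_surjective _ (hsurj D hD ⊤ le_top)
  -- Restriction to a smaller special factor is onto, so at minimal dimension it is bijective.
  obtain ⟨B, hB, hmin⟩ := exists_forall_le_nat (fun B => T.IsSpecialFactor 𝓐 B ∧ h ∈ B)
    (fun B => Module.finrank ℝ (T.ellipticHoms B)) hex
  refine ⟨B, hB, fun D hD hhD hDB => ?_⟩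
  have := hfin' B hB.1
  have := hfin' D hD
  have h1 := hsurj D hD B hDB
  have h2 : Module.finrank ℝ (T.ellipticHoms B) = Module.finrank ℝ (T.ellipticHoms D) :=
    le_antisymm (hmin D ⟨hD, hhD⟩) (LinearMap.finrank_le_finrank_of_surjective h1)
  exact (LinearMap.injective_iff_surjective_of_finrank_eq_finrank h2).2 h1

/-! ### Branches outside the translates of a block -/

/-- `R` is a `B`-invariant set of vertices, disjoint from `Y` and containing `z`, which is bounded
by the `B`-translates of the edge `az`. -/
structure IsBranch (S : GTree G) (B : Subgroup G) (Y : Set S.V) (a z : S.V) (R : Set S.V) :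
    Prop where
  mem : z ∈ R
  not_mem : a ∉ R
  disjoint : ∀ y ∈ Y, y ∉ R
  smul_mem_iff : ∀ b ∈ B, ∀ x, b • x ∈ R ↔ x ∈ R
  boundary : ∀ x y, S.graph.Adj x y → x ∈ R → y ∉ R → ∃ b ∈ B, x = b • z ∧ y = b • a

theorem IsBranch.not_mem_translate {S : GTree G} {B : Subgroup G} {Y : Set S.V} {a z : S.V}
    {R : Set S.V} (h : S.IsBranch B Y a z R) {b : G} (hb : b ∈ B) {x : S.V} (hx : x ∈ R) :
    b • x ∉ Y := fun hy => h.disjoint _ hy ((h.smul_mem_iff b hb x).2 hx)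

section Branch

variable {T S : GTree G} {D B : Subgroup G} {Y : Set S.V}

/-- The signed indicator cochain of the `B`-orbit of `az` vanishes on `Y`, so it has a `B`-invariant
potential. This takes only the values `p a` and `p z`; it is constant on `Y`, and the level set
missing `Y` is the branch. -/
theorem exists_isBranch (hlox : ∀ g : G, S.IsLoxodromic g ↔ T.IsLoxodromic g) (hDB : D ≤ B)
    (hinj : Function.Injective (T.restrictHoms hDB)) (hY : S.IsBlock Y D) {a z : S.V}
    (haz : S.graph.Adj a z) (hno : ¬ ∃ b ∈ B, b • a ∈ Y ∧ b • z ∈ Y) :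
    ∃ R, S.IsBranch B Y a z R ∨ S.IsBranch B Y z a R := by
  classical
  let U : S.V → S.V → Prop := fun x y => ∃ b ∈ B, x = b • a ∧ y = b • z
  have hUU : ∀ x y, U x y → ¬ U y x := by
    rintro x y ⟨b, -, rfl, rfl⟩ ⟨b', -, h1, h2⟩
    refine S.no_inversion (b'⁻¹ * b) a z haz ⟨?_, ?_⟩
    · rw [mul_smul, h2, inv_smul_smul]
    · rw [mul_smul, h1, inv_smul_smul]
  have hUinv : ∀ b ∈ B, ∀ x y, U (b • x) (b • y) ↔ U x y := by
    intro b hb x y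
    constructor
    · rintro ⟨c, hc, h1, h2⟩
      exact ⟨b⁻¹ * c, B.mul_mem (B.inv_mem hb) hc, by rw [mul_smul, ← h1, inv_smul_smul],
        by rw [mul_smul, ← h2, inv_smul_smul]⟩
    · rintro ⟨c, hc, rfl, rfl⟩
      exact ⟨b * c, B.mul_mem hb hc, (mul_smul _ _ _).symm, (mul_smul _ _ _).symm⟩
  have hUY : ∀ x ∈ Y, ∀ y ∈ Y, ¬ U x y := by
    rintro _ hx _ hy ⟨b, hb, rfl, rfl⟩
    exact hno ⟨b, hb, hx, hy⟩
  let c : S.V → S.V → ℝ := fun x y => if U x y then 1 else if U y x then -1 else 0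
  obtain ⟨p, hp, hpB⟩ := exists_invariant_potential hlox hDB hinj hY.subtree hY.smul_mem c
    (fun x y _ => by
      by_cases h1 : U x y
      · simp [c, h1, hUU x y h1]
      · by_cases h2 : U y x <;> simp [c, h1, h2])
    (fun b hb x y _ => by simp only [c, hUinv b hb])
    (fun x hx y hy _ => by simp [c, hUY x hx y hy, hUY y hy x hx])
  have hpz : p z = p a + 1 := by
    have h1 := hp a z haz
    have h2 : U a z := ⟨1, B.one_mem, (one_smul _ _).symm, (one_smul _ _).symm⟩
    simp only [c, if_pos h2] at h1
    linarith
  have hstep : ∀ x y, S.graph.Adj x y → p y = p x ∨ (U x y ∧ p x = p a ∧ p y = p z) ∨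
      (U y x ∧ p x = p z ∧ p y = p a) := by
    intro x y hxy
    have h1 := hp x y hxy
    by_cases h2 : U x y
    · obtain ⟨b, hb, rfl, rfl⟩ := id h2
      exact Or.inr (Or.inl ⟨h2, hpB b hb a, hpB b hb z⟩)
    · by_cases h3 : U y x
      · obtain ⟨b, hb, rfl, rfl⟩ := id h3
        exact Or.inr (Or.inr ⟨h3, hpB b hb z, hpB b hb a⟩)
      · simp only [c, if_neg h2, if_neg h3] at h1
        exact Or.inl (by linarith)
  have htwo : ∀ x, p x = p a ∨ p x = p z := fun x =>
    S.isTree.connected.isSubtree_univ.subset_of_closed (R := {x | p x = p a ∨ p x = p z})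
      (a := a) trivial (Or.inl rfl) (fun x _ y _ hxy hx => by
        rcases hstep x y hxy with h | ⟨-, -, h⟩ | ⟨-, -, h⟩
        · change p y = p a ∨ p y = p z
          rw [h]
          exact hx
        · exact Or.inr h
        · exact Or.inl h) (Set.mem_univ x)
  obtain ⟨y₀, hy₀⟩ := hY.subtree.1
  have hpY : ∀ y ∈ Y, p y = p y₀ := fun y hy => hY.subtree.constant p (fun x hx w hw hxw => by
    rcases hstep x w hxw with h | ⟨h, -⟩ | ⟨h, -⟩
    · exact h.symm
    · exact absurd h (hUY x hx w hw)
    · exact absurd h (hUY w hw x hx)) hy hy₀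
  have hne : p a ≠ p z := by linarith
  rcases htwo y₀ with h0 | h0
  · refine ⟨{x | p x = p z}, Or.inl ⟨rfl, hne, fun y hy h => hne ?_, fun b hb x => ?_, ?_⟩⟩
    · rw [← h0, ← hpY y hy]
      exact h
    · change p (b • x) = p z ↔ p x = p z
      rw [hpB b hb]
    · intro x y hxy (hx : p x = p z) (hy : ¬ p y = p z)
      rcases hstep x y hxy with h | ⟨-, -, h⟩ | ⟨⟨b, hb, h1, h2⟩, -⟩
      · exact absurd (h.trans hx) hy
      · exact absurd h hy
      · exact ⟨b, hb, h2, h1⟩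
  · refine ⟨{x | p x = p a}, Or.inr ⟨rfl, hne.symm, fun y hy h => hne ?_, fun b hb x => ?_, ?_⟩⟩
    · rw [← h0, ← hpY y hy]
      exact Eq.symm h
    · change p (b • x) = p a ↔ p x = p a
      rw [hpB b hb]
    · intro x y hxy (hx : p x = p a) (hy : ¬ p y = p a)
      rcases hstep x y hxy with h | ⟨⟨b, hb, h1, h2⟩, -⟩ | ⟨-, -, h⟩
      · exact absurd (h.trans hx) hy
      · exact ⟨b, hb, h1, h2⟩
      · exact absurd h hy

/-- Two branches at the same vertex are bounded by the same edge. -/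
theorem IsBranch.eq_of_stab_le (hYne : Y.Nonempty) {a a' z : S.V} {R R' : Set S.V}
    (h : S.IsBranch B Y a z R) (h' : S.IsBranch B Y a' z R')
    (hle : S.vertexStab z ≤ S.vertexStab a) : a' = a := by
  obtain ⟨y, hy⟩ := hYne
  have key : ∀ b b' : G, b • z = b' • z → b • a = b' • a' → a' = a := by
    intro b b' h1 h2
    have h3 : b'⁻¹ * b ∈ S.vertexStab z := by
      rw [mem_vertexStab, mul_smul, h1, inv_smul_smul]
    have h4 := hle h3
    rw [mem_vertexStab, mul_smul, h2, inv_smul_smul] at h4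
    exact h4
  by_contra hne
  -- If the two edges differed, no edge could leave both branches at once, so their union would be
  -- the whole tree, although it misses `Y`.
  have := S.isTree.connected.isSubtree_univ.subset_of_closed (R := R ∪ R') (a := z)
    trivial (Or.inl h.mem) (fun x _ w _ hxw hx => by
      by_contra hw
      rw [Set.mem_union, not_or] at hw
      rcases hx with hx | hx
      · obtain ⟨b, hb, rfl, rfl⟩ := h.boundary x w hxw hx hw.1
        obtain ⟨b', -, h1, h2⟩ := h'.boundary _ _ hxw ((h'.smul_mem_iff b hb z).2 h'.mem) hw.2
        exact hne (key b b' h1 h2)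
      · obtain ⟨b', hb', rfl, rfl⟩ := h'.boundary x w hxw hx hw.2
        obtain ⟨b, -, h1, h2⟩ := h.boundary _ _ hxw ((h.smul_mem_iff b' hb' z).2 h.mem) hw.1
        exact hne (key b b' h1.symm h2.symm)) (Set.mem_univ y)
  rcases this with h1 | h1
  · exact h.disjoint y hy h1
  · exact h'.disjoint y hy h1

/-- If stabilizers do not grow away from `Y` inside `Y'` then the two stabilizers agree. -/
theorem IsBlock.le_of_stab_le (hlox : ∀ g : G, S.IsLoxodromic g ↔ T.IsLoxodromic g) (hDB : D ≤ B)
    (hinj : Function.Injective (T.restrictHoms hDB)) (hY : S.IsBlock Y D) {C : Subgroup G}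
    {Y' : Set S.V} (hY' : S.IsBlock Y' C) (hCB : C ≤ B) (hYY' : Y ⊆ Y')
    (hle : ∀ a ∈ Y', ∀ z ∈ Y', ∀ R, S.graph.Adj a z → S.IsBranch B Y a z R →
      S.vertexStab z ≤ S.vertexStab a) : C ≤ D := by
  -- A path in `Y'` that has entered a branch never returns to a `B`-translate of `Y`. Its next edge
  -- bounds a branch too; if that branch contained the near end `z`, the hypothesis on stabilizers
  -- would force the path to backtrack.
  have hup : ∀ {z t : S.V} (p : S.graph.Walk z t) (a : S.V) (haz : S.graph.Adj a z) (R : Set S.V),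
      (Walk.cons haz p).IsPath → (∀ x ∈ (Walk.cons haz p).support, x ∈ Y') →
      S.IsBranch B Y a z R → ∀ b ∈ B, b • t ∉ Y := by
    intro z t p
    induction p with
    | nil => exact fun a haz R _ _ hR b hb => hR.not_mem_translate hb hR.mem
    | @cons z a' t hza' p ih =>
      intro a haz R hpath hsupp hR
      have haY : a ∈ Y' := hsupp a (by simp)
      have hzY : z ∈ Y' := hsupp z (by simp)
      have ha'Y : a' ∈ Y' := hsupp a' (by simp)
      obtain ⟨R', hR' | hR'⟩ := exists_isBranch hlox hDB hinj hY hza'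
        (fun ⟨b, hb, h, _⟩ => hR.not_mem_translate hb hR.mem h)
      · exact ih z hza' R' hpath.of_cons (fun x hx => hsupp x (by
          rw [Walk.support_cons]; exact List.mem_cons_of_mem _ hx)) hR'
      · have haa' := hR.eq_of_stab_le hY.subtree.1 hR' (hle a haY z hzY R haz hR)
        rw [Walk.cons_isPath_iff] at hpath
        subst haa'
        exact absurd (by simp) hpath.2
  have hmain : ∀ {y t : S.V} (p : S.graph.Walk y t), p.IsPath → (∀ x ∈ p.support, x ∈ Y') →
      y ∈ Y → (∃ b ∈ B, b • t ∈ Y) → t ∈ Y := by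
    intro y t p
    induction p with
    | nil => exact fun _ _ h _ => h
    | @cons y y₁ t hyy₁ p ih =>
      intro hpath hsupp hy ht
      by_cases hy₁ : y₁ ∈ Y
      · exact ih hpath.of_cons (fun x hx => hsupp x (by
          rw [Walk.support_cons]; exact List.mem_cons_of_mem _ hx)) hy₁ ht
      · obtain ⟨R, hR | hR⟩ := exists_isBranch hlox hDB hinj hY hyy₁
          (fun ⟨b, _, h1, h2⟩ => hy₁ ((hY.smul_mem_iff (hY.mem_of b y hy h1) y₁).1 h2))
        · obtain ⟨b, hb, hbt⟩ := ht
          exact absurd hbt (hup p y hyy₁ R hpath hsupp hR b hb)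
        · exact absurd hR.mem (hR.disjoint y hy)
  intro c hc
  obtain ⟨y, hy⟩ := hY.subtree.1
  obtain ⟨p, hp, -⟩ := S.isTree.existsUnique_path y (c • y)
  have hcy := hY'.smul_mem c hc y (hYY' hy)
  exact hY.mem_of c y hy (hmain p hp (hY'.subtree.path_subset S.isTree (hYY' hy) hcy hp) hy
    ⟨c⁻¹, B.inv_mem (hCB hc), by rwa [inv_smul_smul]⟩)

/-! ### Sizes of stabilizers along branches -/

/-- The size of a subgroup of a vertex stabilizer, normalized by a potential. -/
noncomputable def size (S : GTree G) (p : S.V → ℝ) (x : S.V) (L : Subgroup G) : ℝ :=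
  p x - Real.log (L.relIndex (S.vertexStab x))

/-- Both indices of `L` factor through the edge group; their ratio is the local modulus, which is
the prescribed increment of `p`. -/
theorem size_eq_of_adj {p : S.V → ℝ} {x y : S.V}
    (hp : p y - p x = Real.log ((S.vertexStab x).relIndex (S.vertexStab y)) -
      Real.log ((S.vertexStab y).relIndex (S.vertexStab x))) {L : Subgroup G}
    (hx : L ≤ S.vertexStab x) (hy : L ≤ S.vertexStab y)
    (hLx : L.relIndex (S.vertexStab x) ≠ 0) (hLy : L.relIndex (S.vertexStab y) ≠ 0) :
    S.size p x L = S.size p y L := by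
  have h1 := Subgroup.relIndex_mul_relIndex L (S.vertexStab y ⊓ S.vertexStab x)
    (S.vertexStab x) (le_inf hy hx) inf_le_right
  have h2 := Subgroup.relIndex_mul_relIndex L (S.vertexStab x ⊓ S.vertexStab y)
    (S.vertexStab y) (le_inf hx hy) inf_le_right
  rw [Subgroup.inf_relIndex_right] at h1 h2
  rw [inf_comm] at h2
  have h3 : L.relIndex (S.vertexStab y ⊓ S.vertexStab x) ≠ 0 := fun h => hLx (by
    rw [← h1, h, zero_mul])
  have h4 : (S.vertexStab y).relIndex (S.vertexStab x) ≠ 0 := fun h => hLx (by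
    rw [← h1, h, mul_zero])
  have h5 : (S.vertexStab x).relIndex (S.vertexStab y) ≠ 0 := fun h => hLy (by
    rw [← h2, h, mul_zero])
  rw [size, size, ← h1, ← h2]
  push_cast
  rw [Real.log_mul (Nat.cast_ne_zero.2 h3) (Nat.cast_ne_zero.2 h4),
    Real.log_mul (Nat.cast_ne_zero.2 h3) (Nat.cast_ne_zero.2 h5)]
  linarith

/-- Size is constant along a walk fixed by `L` inside the branch. The walk either stays there or
leaves through a translate of the boundary edge, which `L` then fixes. -/
theorem IsBranch.size_walk {p : S.V → ℝ} {a z : S.V} {R : Set S.V} (hR : S.IsBranch B Y a z R)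
    (hp : ∀ x ∈ R, ∀ y ∈ R, S.graph.Adj x y →
      p y - p x = Real.log ((S.vertexStab x).relIndex (S.vertexStab y)) -
        Real.log ((S.vertexStab y).relIndex (S.vertexStab x))) {L : Subgroup G}
    (hL : ∀ v, L.relIndex (S.vertexStab v) ≠ 0) {x u : S.V} (w : S.graph.Walk x u)
    (hw : ∀ y ∈ w.support, L ≤ S.vertexStab y) (hx : x ∈ R) :
    (u ∈ R ∧ S.size p x L = S.size p u L) ∨ ∃ b ∈ B, L ≤ S.vertexStab (b • a) ∧
      L ≤ S.vertexStab (b • z) ∧ S.size p x L = S.size p (b • z) L := by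
  induction w with
  | nil => exact Or.inl ⟨hx, rfl⟩
  | @cons x y u hxy w ih =>
    have hLx := hw x (by simp)
    have hLy := hw y (by simp)
    by_cases hy : y ∈ R
    · have h1 := size_eq_of_adj (hp x hx y hy hxy) hLx hLy (hL x) (hL y)
      rw [h1]
      exact ih (fun v hv => hw v (by rw [Walk.support_cons]; exact List.mem_cons_of_mem _ hv)) hy
    · obtain ⟨b, hb, rfl, rfl⟩ := hR.boundary x y hxy hx hy
      exact Or.inr ⟨b, hb, hLy, hLx, rfl⟩

/-- The logarithmic modulus may have nonzero periods on `D`. Setting it to zero on the translates of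
`Y` removes them without affecting branches. -/
theorem exists_size_potential (hlox : ∀ g : G, S.IsLoxodromic g ↔ T.IsLoxodromic g) (hDB : D ≤ B)
    (hinj : Function.Injective (T.restrictHoms hDB)) (hY : S.IsBlock Y D) :
    ∃ p : S.V → ℝ, (∀ b ∈ B, ∀ x, p (b • x) = p x) ∧
      ∀ x y, S.graph.Adj x y → (¬ ∃ b ∈ B, b • x ∈ Y ∧ b • y ∈ Y) →
        p y - p x = Real.log ((S.vertexStab x).relIndex (S.vertexStab y)) -
          Real.log ((S.vertexStab y).relIndex (S.vertexStab x)) := by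
  classical
  let P : S.V → S.V → Prop := fun x y => ∃ b ∈ B, b • x ∈ Y ∧ b • y ∈ Y
  have hPs : ∀ x y, P y x ↔ P x y := fun x y =>
    ⟨fun ⟨b, hb, h1, h2⟩ => ⟨b, hb, h2, h1⟩, fun ⟨b, hb, h1, h2⟩ => ⟨b, hb, h2, h1⟩⟩
  have hPB : ∀ b ∈ B, ∀ x y, P (b • x) (b • y) ↔ P x y := fun b hb x y =>
    ⟨fun ⟨c, hc, h1, h2⟩ => ⟨c * b, B.mul_mem hc hb, by rwa [mul_smul], by rwa [mul_smul]⟩,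
      fun ⟨c, hc, h1, h2⟩ => ⟨c * b⁻¹, B.mul_mem hc (B.inv_mem hb),
        by rwa [mul_smul, inv_smul_smul], by rwa [mul_smul, inv_smul_smul]⟩⟩
  let r : S.V → S.V → ℝ := fun x y => Real.log ((S.vertexStab x).relIndex (S.vertexStab y)) -
          Real.log ((S.vertexStab y).relIndex (S.vertexStab x))
  have hr : ∀ (g : G) x y, r (g • x) (g • y) = r x y := fun g x y => by
    simp only [r, vertexStab_smul, autImage]
    rw [Subgroup.relIndex_map_map_of_injective _ _ (MulEquiv.injective _),
      Subgroup.relIndex_map_map_of_injective _ _ (MulEquiv.injective _)]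
  obtain ⟨p, hp, hpB⟩ := exists_invariant_potential hlox hDB hinj hY.subtree hY.smul_mem
    (fun x y => if P x y then 0 else r x y)
    (fun x y _ => by
      simp only [hPs x y]
      split_ifs
      · simp
      · simp [r])
    (fun b hb x y _ => by simp only [hPB b hb, hr])
    (fun x hx y hy _ => if_pos ⟨1, B.one_mem, by simpa using hx, by simpa using hy⟩)
  refine ⟨p, hpB, fun x y hxy hno => ?_⟩
  have := hp x y hxy
  rwa [if_neg hno] at this

end Branch

/-- The key rigidity statement: a smaller block whose intersections with elliptic subgroups are not
smaller has the same stabilizer. -/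
theorem IsBlock.le_of_relIndex_le {T S : GTree G} (hS : S ∈ T.deformationSpace) {D C B : Subgroup G}
    (hDB : D ≤ B) (hinj : Function.Injective (T.restrictHoms hDB)) {Y Y' : Set S.V}
    (hY : S.IsBlock Y D) (hY' : S.IsBlock Y' C) (hCB : C ≤ B) (hYY' : Y ⊆ Y')
    (hH : ∀ H : Subgroup G, T.IsElliptic H → H ≤ C → (∃ v : S.V, H = S.vertexStab v) →
      ∃ (K : Subgroup G) (b : G), T.IsElliptic K ∧ H ≤ K ∧ b ∈ B ∧
        (autImage (MulAut.conj b) D).relIndex K ≠ 0 ∧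
        (autImage (MulAut.conj b) D).relIndex K ≤ H.relIndex K) : C ≤ D := by
  have hlox : ∀ g : G, S.IsLoxodromic g ↔ T.IsLoxodromic g := fun g => isLoxodromic_congr hS.2
  refine hY.le_of_stab_le hlox hDB hinj hY' hCB hYY' fun a _ z hz R haz hR => ?_
  obtain ⟨p, hpB, hp⟩ := exists_size_potential hlox hDB hinj hY
  have hpR : ∀ x ∈ R, ∀ y ∈ R, S.graph.Adj x y →
      p y - p x = Real.log ((S.vertexStab x).relIndex (S.vertexStab y)) -
        Real.log ((S.vertexStab y).relIndex (S.vertexStab x)) := fun x hx y _ hxy =>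
    hp x y hxy (fun ⟨b, hb, h, _⟩ => hR.not_mem_translate hb hx h)
  have hconj : ∀ b : G, S.vertexStab (b • z) ≤ S.vertexStab (b • a) →
      S.vertexStab z ≤ S.vertexStab a := by
    intro b h
    rw [vertexStab_smul, vertexStab_smul] at h
    exact (Subgroup.map_le_map_iff_of_injective (MulEquiv.injective (MulAut.conj b))).1 h
  have hfix : ∀ {x u : S.V} {L : Subgroup G}, L ≤ S.vertexStab x → L ≤ S.vertexStab u →
      ∃ w : S.graph.Walk x u, ∀ y ∈ w.support, L ≤ S.vertexStab y := by
    intro x u L hx hu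
    obtain ⟨w, -, hw⟩ := S.exists_fixed_walk x u
    exact ⟨w, fun y hy g hg => hw g (hx hg) (hu hg) y hy⟩
  have hidx : ∀ {L : Subgroup G} {v : S.V}, L.relIndex (S.vertexStab v) ≠ 0 →
      Real.log (L.relIndex (S.vertexStab v)) ≤ 0 → S.vertexStab v ≤ L := by
    intro L v h0 hlog
    rw [← Subgroup.relIndex_eq_one]
    have h1 : (1 : ℝ) ≤ L.relIndex (S.vertexStab v) := by
      exact_mod_cast Nat.one_le_iff_ne_zero.2 h0
    have h2 : (L.relIndex (S.vertexStab v) : ℝ) ≤ 1 := by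
      by_contra hcon
      push Not at hcon
      exact absurd hlog (not_le.2 (Real.log_pos hcon))
    exact_mod_cast le_antisymm h2 h1
  obtain ⟨K, b, hK, hzK, hb, h0, hle⟩ := hH (S.vertexStab z)
    ((hS.2 _).1 (S.isElliptic_vertexStab z)) (hY'.vertexStab_le hz) ⟨z, rfl⟩
  obtain ⟨u, hu⟩ := (hS.2 K).2 hK
  have hcomm := hS.1.commensurable
  obtain ⟨w, hw⟩ := hfix le_rfl (hzK.trans hu)
  -- Follow `Stab(z)` from `z` to a vertex `u` fixed by `K`. If the walk leaves the branch across `c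
  -- • z`, `c • a`, equality of sizes makes `Stab(z)` all of `Stab(c • z)`, which therefore fixes `c
  -- • a`.
  rcases hR.size_walk hpR (fun v => (hcomm z v).1) w hw hR.mem with ⟨huR, hsz⟩ | ⟨c, hc, h1, h2, h3⟩
  · set L := K ⊓ autImage (MulAut.conj b) D with hLdef
    have hLK : L.relIndex K = (autImage (MulAut.conj b) D).relIndex K := by
      rw [hLdef, Subgroup.inf_relIndex_left]
    have hKu : K.relIndex (S.vertexStab u) ≠ 0 := fun h =>
      (hcomm z u).1 (Subgroup.relIndex_eq_zero_of_le_left hzK h)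
    have hLu : L.relIndex (S.vertexStab u) = L.relIndex K * K.relIndex (S.vertexStab u) :=
      (Subgroup.relIndex_mul_relIndex L K _ inf_le_left hu).symm
    have hzu : (S.vertexStab z).relIndex (S.vertexStab u) =
        (S.vertexStab z).relIndex K * K.relIndex (S.vertexStab u) :=
      (Subgroup.relIndex_mul_relIndex _ K _ hzK hu).symm
    have hLu0 : L.relIndex (S.vertexStab u) ≠ 0 := by
      rw [hLu, hLK]
      exact mul_ne_zero h0 hKu
    have hLcomm : ∀ v, L.relIndex (S.vertexStab v) ≠ 0 := fun v =>
      ((commensurable_of_le (inf_le_left.trans hu) hLu0).trans (hcomm u v)).1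
    have hLle : (L.relIndex (S.vertexStab u) : ℝ) ≤ (S.vertexStab z).relIndex (S.vertexStab u) := by
      rw [hLu, hzu, hLK]
      exact_mod_cast Nat.mul_le_mul_right _ hle
    have hYb := hY.translate b
    -- If `u` lies in the branch, `L` fixes a vertex of `b • Y`, outside the branch, so the walk
    -- from `u` must exit. As `L` is at least as large as `Stab(z)` when measured in `Stab(u)`, at
    -- the exit it fills `Stab(c • z)`.
    obtain ⟨q, hq, hLq⟩ := S.exists_fixed_mem hYb.subtree (H := L)
      (fun g hg y hy => hYb.smul_mem g hg.2 y hy) ⟨u, inf_le_left.trans hu⟩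
    have hqR : q ∉ R := fun hqR => hR.not_mem_translate (B.inv_mem hb) hqR hq
    obtain ⟨w', hw'⟩ := hfix (inf_le_left.trans hu : L ≤ S.vertexStab u) hLq
    rcases hR.size_walk hpR hLcomm w' hw' huR with ⟨h, -⟩ | ⟨c, hc, h1, h2, h3⟩
    · exact absurd h hqR
    · refine hconj c ((hidx (hLcomm (c • z)) ?_).trans h1)
      have h4 : Real.log (L.relIndex (S.vertexStab u)) ≤
          Real.log ((S.vertexStab z).relIndex (S.vertexStab u)) :=
        Real.log_le_log (by exact_mod_cast Nat.pos_of_ne_zero hLu0) hLle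
      rw [size, size, Subgroup.relIndex_self, Nat.cast_one, Real.log_one] at hsz
      rw [size, size, hpB c hc] at h3
      linarith
  · refine hconj c ((hidx (hcomm z _).1 ?_).trans h1)
    rw [size, size, Subgroup.relIndex_self, Nat.cast_one, Real.log_one, hpB c hc] at h3
    linarith

end GTree

/-! ### Minimal indices and the least special factor -/

theorem autImage_one {G : Type u} [Group G] (H : Subgroup G) : autImage 1 H = H := by
  ext x
  simp [autImage, Subgroup.mem_map]

theorem autImage_mul {G : Type u} [Group G] (φ ψ : MulAut G) (H : Subgroup G) :
    autImage (φ * ψ) H = autImage φ (autImage ψ H) :=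
  (Subgroup.map_map H φ.toMonoidHom ψ.toMonoidHom).symm

theorem relIndex_autImage {G : Type u} [Group G] (φ : MulAut G) (H K : Subgroup G) :
    (autImage φ H).relIndex (autImage φ K) = H.relIndex K :=
  Subgroup.relIndex_map_map_of_injective H K φ.injective

theorem relIndex_autImage_right {G : Type u} [Group G] (φ : MulAut G) (H K : Subgroup G) :
    H.relIndex (autImage φ K) = (autImage φ⁻¹ H).relIndex K := by
  rw [← relIndex_autImage φ (autImage φ⁻¹ H), ← autImage_mul, mul_inv_cancel, autImage_one]

theorem relIndex_le_of_le_left {G : Type*} [Group G] {H K L : Subgroup G} (h : H ≤ K)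
    (h0 : H.relIndex L ≠ 0) : K.relIndex L ≤ H.relIndex L :=
  Nat.le_of_dvd (Nat.pos_of_ne_zero h0) (Subgroup.relIndex_dvd_of_le_left L h)

/-- The smallest index of the intersection with `K` of a conjugate of `C` by an element of `B`. -/
noncomputable def minRelIndex {G : Type u} [Group G] (B C K : Subgroup G) : ℕ :=
  -- The value `0` of `relIndex` stands for infinite index and is excluded.
  sInf {n | n ≠ 0 ∧ ∃ b ∈ B, n = (autImage (MulAut.conj b) C).relIndex K}

theorem minRelIndex_le {G : Type u} [Group G] (B : Subgroup G) {C K : Subgroup G}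
    (h : C.relIndex K ≠ 0) : minRelIndex B C K ≤ C.relIndex K :=
  Nat.sInf_le ⟨h, 1, B.one_mem, by rw [map_one, autImage_one]⟩

theorem exists_relIndex_eq_minRelIndex {G : Type u} [Group G] (B : Subgroup G) {C K : Subgroup G}
    (h : C.relIndex K ≠ 0) : minRelIndex B C K ≠ 0 ∧
      ∃ b ∈ B, minRelIndex B C K = (autImage (MulAut.conj b) C).relIndex K :=
  Nat.sInf_mem (s := {n | n ≠ 0 ∧ ∃ b ∈ B, n = (autImage (MulAut.conj b) C).relIndex K})
    ⟨_, h, 1, B.one_mem, by rw [map_one, autImage_one]⟩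

theorem minRelIndex_mono {G : Type u} [Group G] (B : Subgroup G) {D C K : Subgroup G} (hDC : D ≤ C)
    (h : D.relIndex K ≠ 0) : minRelIndex B C K ≤ minRelIndex B D K := by
  obtain ⟨h0, b, hb, hbD⟩ := exists_relIndex_eq_minRelIndex B h
  rw [hbD] at h0 ⊢
  have hle : autImage (MulAut.conj b) D ≤ autImage (MulAut.conj b) C := Subgroup.map_mono hDC
  exact (Nat.sInf_le (s := {n | n ≠ 0 ∧ ∃ b ∈ B, n = (autImage (MulAut.conj b) C).relIndex K})
    ⟨fun h => h0 (Subgroup.relIndex_eq_zero_of_le_left hle h), b, hb, rfl⟩).trans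
    (relIndex_le_of_le_left hle h0)

/-- Invariance under `B` is the reason for minimizing over conjugates: finitely many vertices then
control all vertices of a block for `B`. -/
theorem minRelIndex_conj {G : Type u} [Group G] {B : Subgroup G} (C K : Subgroup G) {b : G}
    (hb : b ∈ B) : minRelIndex B C (autImage (MulAut.conj b) K) = minRelIndex B C K := by
  unfold minRelIndex
  congr 1
  ext n
  refine and_congr_right fun _ => ⟨?_, ?_⟩
  · rintro ⟨c, hc, rfl⟩
    refine ⟨b⁻¹ * c, B.mul_mem (B.inv_mem hb) hc, ?_⟩
    rw [relIndex_autImage_right, ← map_inv, ← autImage_mul, ← map_mul]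
  · rintro ⟨c, hc, rfl⟩
    refine ⟨b * c, B.mul_mem hb hc, ?_⟩
    rw [relIndex_autImage_right, ← map_inv, ← autImage_mul, ← map_mul, inv_mul_cancel_left]

namespace GTree

variable {G : Type u} [Group G]

theorem IsBlock.exists_finite_reps {S : GTree G} (hS : S.IsCocompact) {Y : Set S.V}
    {B : Subgroup G} (hY : S.IsBlock Y B) :
    ∃ F : Set S.V, F.Finite ∧ F ⊆ Y ∧ ∀ y ∈ Y, ∃ b ∈ B, b • y ∈ F := by
  classical
  obtain ⟨⟨s, hs, hcov⟩, -⟩ := hS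
  have hr : ∀ e : S.V, ∃ y : S.V, (∃ y' ∈ Y, ∃ g : G, g • y' = e) → y ∈ Y ∧ ∃ g : G, g • y = e := by
    intro e
    by_cases h : ∃ y' ∈ Y, ∃ g : G, g • y' = e
    · obtain ⟨y, hy, g, hg⟩ := h
      exact ⟨y, fun _ => ⟨hy, g, hg⟩⟩
    · exact ⟨e, fun h' => absurd h' h⟩
  choose r hr using hr
  refine ⟨r '' s ∩ Y, (hs.image r).subset Set.inter_subset_left, Set.inter_subset_right,
    fun y hy => ?_⟩
  obtain ⟨g, hg⟩ := hcov y
  obtain ⟨hrY, g', hg'⟩ := hr (g • y) ⟨y, hy, g, rfl⟩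
  have hmem : (g'⁻¹ * g) • y = r (g • y) := by
    rw [mul_smul, inv_smul_eq_iff, hg']
  refine ⟨g'⁻¹ * g, hY.mem_of _ y hy (by rw [hmem]; exact hrY), ?_⟩
  rw [hmem]
  exact ⟨⟨_, hg, rfl⟩, hrY⟩

theorem IsSpecialFactor.inf_conj_le {T : GTree G} {𝓐 : Set (Subgroup G)} {B : Subgroup G}
    (hB : T.IsSpecialFactor 𝓐 B) {x : G} (hx : x ∈ B) (hlox : T.IsLoxodromic x) {H : Subgroup G}
    (hH : T.IsElliptic H) : H ⊓ autImage (MulAut.conj x) H ≤ B := by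
  obtain ⟨-, S, hS, Y, hY⟩ := isSpecialFactor_iff.1 hB
  exact hY.inf_conj_le hx ((isLoxodromic_congr hS.1.2).2 hlox) ((hS.1.2 H).2 hH)

/-- A loxodromic element which lies in a special factor lies in a least one. -/
theorem exists_isLeast_specialFactor {T : GTree G} (hT : T.IsGBSTree) {𝓐 : Set (Subgroup G)}
    (h𝓐 : ∀ H ∈ 𝓐, ∀ K : Subgroup G, K ≤ H → K ∈ 𝓐) {h : G} (hh : T.IsLoxodromic h)
    (hex : ∃ B, T.IsSpecialFactor 𝓐 B ∧ h ∈ B) :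
    ∃ A, IsLeast {B : Subgroup G | T.IsSpecialFactor 𝓐 B ∧ h ∈ B} A := by
  obtain ⟨B, ⟨hB, hhB⟩, hrigid⟩ := exists_rigid_specialFactor hT hex
  obtain ⟨-, S₀, hS₀, Y₀, hY₀⟩ := isSpecialFactor_iff.1 hB
  obtain ⟨v₀⟩ := T.isTree.connected.nonempty
  set K := T.vertexStab v₀ ⊓ autImage (MulAut.conj h) (T.vertexStab v₀) with hK
  have hKcomm : ∀ v : S₀.V, K.relIndex (S₀.vertexStab v) ≠ 0 := by
    intro v
    have h1 : Subgroup.Commensurable K (T.vertexStab v₀) := by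
      rw [hK, ← vertexStab_smul]
      exact commensurable_inf_left (hT.commensurable _ _)
    exact (h1.trans (commensurable_of_mem (mem_deformationSpace_self hT) hS₀.1 v₀ v)).1
  have hKle : ∀ C, T.IsSpecialFactor 𝓐 C → h ∈ C → K ≤ C := fun C hC hhC =>
    hC.inf_conj_le hhC hh (T.isElliptic_vertexStab v₀)
  have hne : ∀ C, T.IsSpecialFactor 𝓐 C → h ∈ C → ∀ v, C.relIndex (S₀.vertexStab v) ≠ 0 :=
    fun C hC hhC v h0 => hKcomm v (Subgroup.relIndex_eq_zero_of_le_left (hKle C hC hhC) h0)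
  obtain ⟨F, hF, hFY, hFcov⟩ := hY₀.exists_finite_reps hS₀.1.1.cocompact
  -- Minimizing this sum maximizes the indices of `C`. They are bounded by those of `K`, which lies
  -- in every competing factor, so the truncated subtraction loses nothing.
  obtain ⟨C, ⟨⟨hC, hhC⟩, hCB⟩, hmin⟩ := exists_forall_le_nat
    (fun C => (T.IsSpecialFactor 𝓐 C ∧ h ∈ C) ∧ C ≤ B)
    (fun C => ∑ v ∈ hF.toFinset, (K.relIndex (S₀.vertexStab v) - minRelIndex B C (S₀.vertexStab v)))
    ⟨B, ⟨hB, hhB⟩, le_rfl⟩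
  refine ⟨C, ⟨hC, hhC⟩, ?_⟩
  rintro E ⟨hE, hhE⟩
  obtain ⟨S, hS, Y, Y', hY, hY', hYY⟩ := exists_nested_blocks hT h𝓐 hC hE hh hhC hhE
  have hhD : h ∈ C ⊓ E := ⟨hhC, hhE⟩
  have hD : T.IsSpecialFactor 𝓐 (C ⊓ E) :=
    isSpecialFactor_iff.2 ⟨fun ⟨v, hv⟩ => hh v (hv hhD), S, hS, Y', hY'⟩
  have hDB : C ⊓ E ≤ B := inf_le_left.trans hCB
  have hle : ∀ v, minRelIndex B C (S₀.vertexStab v) ≤ minRelIndex B (C ⊓ E) (S₀.vertexStab v) :=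
    fun v => minRelIndex_mono B inf_le_left (hne _ hD hhD v)
  have hleK : ∀ v, minRelIndex B (C ⊓ E) (S₀.vertexStab v) ≤ K.relIndex (S₀.vertexStab v) :=
    fun v => (minRelIndex_le B (hne _ hD hhD v)).trans
      (relIndex_le_of_le_left (hKle _ hD hhD) (hKcomm v))
  have heqF : ∀ v ∈ F, minRelIndex B (C ⊓ E) (S₀.vertexStab v) =
      minRelIndex B C (S₀.vertexStab v) := by
    have hterm : ∀ v ∈ hF.toFinset,
        K.relIndex (S₀.vertexStab v) - minRelIndex B (C ⊓ E) (S₀.vertexStab v) ≤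
        K.relIndex (S₀.vertexStab v) - minRelIndex B C (S₀.vertexStab v) :=
      fun v _ => Nat.sub_le_sub_left (hle v) _
    have hsum := (Finset.sum_eq_sum_iff_of_le hterm).1
      (le_antisymm (Finset.sum_le_sum hterm) (hmin _ ⟨⟨hD, hhD⟩, hDB⟩))
    intro v hv
    have h1 := hsum v (hF.mem_toFinset.2 hv)
    have h2 := hle v
    have h3 := hleK v
    omega
  have heq : ∀ v ∈ Y₀, minRelIndex B (C ⊓ E) (S₀.vertexStab v) =
      minRelIndex B C (S₀.vertexStab v) := by
    intro v hv
    obtain ⟨b, hb, hbv⟩ := hFcov v hv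
    have := heqF _ hbv
    rwa [vertexStab_smul, minRelIndex_conj _ _ hb, minRelIndex_conj _ _ hb] at this
  refine le_trans (hY'.le_of_relIndex_le hS.1 hDB (hrigid _ hD hhD hDB) hY hCB hYY ?_) inf_le_right
  rintro H hHell hHC ⟨v, rfl⟩
  obtain ⟨y, hy, hHy⟩ := S₀.exists_fixed_mem hY₀.subtree
    (fun g hg y hy => hY₀.smul_mem g (hCB (hHC hg)) y hy) ((hS₀.1.2 _).2 hHell)
  obtain ⟨h0, b, hb, hbD⟩ := exists_relIndex_eq_minRelIndex B (hne _ hD hhD y)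
  -- The stabilizer of `y` in `S₀` serves as the larger elliptic group: there the least index of `C
  -- ⊓ E` equals that of `C`, which is at most the index of `H ≤ C`.
  refine ⟨S₀.vertexStab y, b, (hS₀.1.2 _).1 (S₀.isElliptic_vertexStab y), hHy, hb, hbD ▸ h0, ?_⟩
  rw [← hbD, heq y hy]
  exact (minRelIndex_le B (hne _ hC hhC y)).trans
    (relIndex_le_of_le_left hHC (commensurable_of_mem hS.1 hS₀.1 v y).1)

end GTree

/-! ### Automorphisms acting on trees and special factors -/

theorem mem_autImage {G : Type u} [Group G] {φ : MulAut G} {H : Subgroup G} {g : G} :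
    g ∈ autImage φ H ↔ φ⁻¹ g ∈ H := by
  rw [autImage, Subgroup.mem_map]
  constructor
  · rintro ⟨b, hb, rfl⟩
    simpa using hb
  · intro h
    exact ⟨_, h, by simp⟩

theorem apply_mem_autImage {G : Type u} [Group G] {φ : MulAut G} {H : Subgroup G} {g : G} :
    φ g ∈ autImage φ H ↔ g ∈ H := by
  rw [mem_autImage]
  simp

/-- The automorphisms preserving a set of subgroups. -/
def autStabilizer {G : Type u} [Group G] (𝓐 : Set (Subgroup G)) : Subgroup (MulAut G) where
  carrier := {φ | ∀ H, autImage φ H ∈ 𝓐 ↔ H ∈ 𝓐}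
  one_mem' H := by rw [autImage_one]
  mul_mem' {φ ψ} hφ hψ H := by rw [autImage_mul, hφ, hψ]
  inv_mem' {φ} hφ H := by rw [← hφ, ← autImage_mul, mul_inv_cancel, autImage_one]

theorem IsEdgeFamily.mem_autStabilizer {G : Type u} [Group G] {Φ : OutAut G}
    {𝓐 : Set (Subgroup G)} (h : IsEdgeFamily Φ 𝓐) {φ : MulAut G} (hφ : outClass φ = Φ) :
    φ ∈ autStabilizer 𝓐 :=
  h.invariant φ hφ

theorem IsEdgeFamily.conj_mem_autStabilizer {G : Type u} [Group G] {Φ : OutAut G}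
    {𝓐 : Set (Subgroup G)} (h : IsEdgeFamily Φ 𝓐) (g : G) : MulAut.conj g ∈ autStabilizer 𝓐 := by
  intro H
  refine ⟨fun hH => ?_, fun hH => h.conj H hH g⟩
  have := h.conj _ hH g⁻¹
  rwa [← autImage_mul, ← map_mul, inv_mul_cancel, map_one, autImage_one] at this

namespace GTree

variable {G : Type u} [Group G]

/-- The tree `S` with the action precomposed with `φ⁻¹`. -/
def twist (S : GTree G) (φ : MulAut G) : GTree G where
  V := S.V
  act := MulAction.compHom S.V (φ⁻¹ : MulAut G).toMonoidHom
  graph := S.graph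
  isTree := S.isTree
  adj_smul g := S.adj_smul (φ⁻¹ g)
  no_inversion g := S.no_inversion (φ⁻¹ g)

theorem vertexStab_twist (S : GTree G) (φ : MulAut G) (v : S.V) :
    (S.twist φ).vertexStab v = autImage φ (S.vertexStab v) := by
  ext g
  rw [mem_autImage]
  exact Iff.rfl

theorem edgeStab_twist (S : GTree G) (φ : MulAut G) (v w : S.V) :
    (S.twist φ).edgeStab v w = autImage φ (S.edgeStab v w) := by
  ext g
  rw [mem_autImage]
  exact Iff.rfl

theorem isElliptic_twist {S : GTree G} {φ : MulAut G} {H : Subgroup G} :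
    (S.twist φ).IsElliptic (autImage φ H) ↔ S.IsElliptic H := by
  refine exists_congr fun v => ?_
  exact (iff_of_eq (congrArg (autImage φ H ≤ ·) (vertexStab_twist S φ v))).trans
    (Subgroup.map_le_map_iff_of_injective (f := φ.toMonoidHom) φ.injective)

theorem IsBlock.twist {S : GTree G} {Y : Set S.V} {B : Subgroup G} (hY : S.IsBlock Y B)
    (φ : MulAut G) : (S.twist φ).IsBlock Y (autImage φ B) where
  subtree := hY.subtree
  smul_mem _ hg := hY.smul_mem _ (mem_autImage.1 hg)
  mem_of _ y hy hgy := mem_autImage.2 (hY.mem_of _ y hy hgy)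

theorem isInfiniteCyclic_autImage {H : Subgroup G} (hH : IsInfiniteCyclic H) (φ : MulAut G) :
    IsInfiniteCyclic (autImage φ H) := by
  obtain ⟨h1, h2⟩ := hH
  let e : H ≃* autImage φ H := H.equivMapOfInjective φ.toMonoidHom φ.injective
  exact ⟨isCyclic_of_surjective e e.surjective, Infinite.of_injective e e.injective⟩

theorem IsGBSTree.twist {S : GTree G} (hS : S.IsGBSTree) (φ : MulAut G) :
    (S.twist φ).IsGBSTree where
  minimal s hs hconn := hS.minimal s (fun g v hv => by
    have : (φ⁻¹ : MulAut G) (φ g) • v ∈ s := hs (φ g) v hv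
    rwa [MulAut.inv_apply_self] at this) hconn
  cocompact := by
    obtain ⟨⟨s, hs, hcov⟩, t, ht, hcov'⟩ := hS.cocompact
    refine ⟨⟨s, hs, fun v => ?_⟩, t, ht, fun v w hvw => ?_⟩
    · obtain ⟨g, hg⟩ := hcov v
      refine ⟨φ g, ?_⟩
      rw [← MulAut.inv_apply_self G φ g] at hg
      exact hg
    · obtain ⟨g, hg⟩ := hcov' v w hvw
      refine ⟨φ g, ?_⟩
      rw [← MulAut.inv_apply_self G φ g] at hg
      exact hg
  vertex_cyclic v := (congrArg IsInfiniteCyclic (vertexStab_twist S φ v)).mpr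
    (isInfiniteCyclic_autImage (hS.vertex_cyclic v) φ)
  edge_cyclic v w hvw := (congrArg IsInfiniteCyclic (edgeStab_twist S φ v w)).mpr
    (isInfiniteCyclic_autImage (hS.edge_cyclic v w hvw) φ)

/-- If there is a proper special factor containing a loxodromic element, commensurated elements
are elliptic. -/
theorem IsSimpleElement.not_isLoxodromic {T : GTree G} {𝓐 : Set (Subgroup G)} {h : G}
    (hh : T.IsSimpleElement 𝓐 h) {a : G} (ha : IsCommensuratedElement a) : ¬ T.IsLoxodromic a := by
  obtain ⟨hlox, B, hB, hne, hhB⟩ := hh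
  obtain ⟨-, S, hS, Y, hY⟩ := isSpecialFactor_iff.1 hB
  rw [← isLoxodromic_congr hS.1.2] at hlox ⊢
  exact hY.not_isLoxodromic hhB hlox hne ha

/-- An elliptic subgroup lies in a vertex group, generated by a commensurated element. Automorphisms
preserve commensuration, and `hcomm` makes the image of the generator elliptic. -/
theorem isElliptic_autImage {T : GTree G} (hT : T.IsGBSTree)
    (hcomm : ∀ a, IsCommensuratedElement a → ¬ T.IsLoxodromic a) {H : Subgroup G} (φ : MulAut G) :
    T.IsElliptic (autImage φ H) ↔ T.IsElliptic H := by
  have key : ∀ (ψ : MulAut G) (K : Subgroup G), T.IsElliptic K → T.IsElliptic (autImage ψ K) := by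
    rintro ψ K ⟨v, hv⟩
    obtain ⟨⟨t, ht⟩, hgen⟩ := (hT.vertex_cyclic v).1.exists_generator
    have h1 := isElliptic_zpowers.2 (hcomm _ ((hT.isCommensuratedElement ht).map ψ))
    refine h1.mono fun g hg => ?_
    obtain ⟨k, hk⟩ := Subgroup.mem_zpowers_iff.1 (hgen ⟨_, hv (mem_autImage.1 hg)⟩)
    have hk' : t ^ k = ψ⁻¹ g := congrArg Subtype.val hk
    refine Subgroup.mem_zpowers_iff.2 ⟨k, ?_⟩
    rw [← map_zpow, hk', MulAut.apply_inv_self]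
  refine ⟨fun h => ?_, key φ H⟩
  have := key φ⁻¹ _ h
  rwa [← autImage_mul, inv_mul_cancel, autImage_one] at this

theorem isLoxodromic_map {T : GTree G} (hT : T.IsGBSTree)
    (hcomm : ∀ a, IsCommensuratedElement a → ¬ T.IsLoxodromic a) {g : G} (hg : T.IsLoxodromic g)
    (φ : MulAut G) : T.IsLoxodromic (φ g) := by
  by_contra hcon
  rw [← isElliptic_zpowers] at hcon
  have : Subgroup.zpowers (φ g) = autImage φ (Subgroup.zpowers g) :=
    (MonoidHom.map_zpowers φ.toMonoidHom g).symm
  rw [this, isElliptic_autImage hT hcomm, isElliptic_zpowers] at hcon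
  exact hcon hg

theorem IsSpecialFactor.map {T : GTree G} (hT : T.IsGBSTree)
    (hcomm : ∀ a, IsCommensuratedElement a → ¬ T.IsLoxodromic a) {𝓐 : Set (Subgroup G)}
    {B : Subgroup G} (hB : T.IsSpecialFactor 𝓐 B) {φ : MulAut G} (hφ : φ ∈ autStabilizer 𝓐) :
    T.IsSpecialFactor 𝓐 (autImage φ B) := by
  obtain ⟨hell, S, hS, Y, hY⟩ := isSpecialFactor_iff.1 hB
  refine isSpecialFactor_iff.2 ⟨by rwa [isElliptic_autImage hT hcomm], S.twist φ,
    ⟨⟨hS.1.1.twist φ, fun H => ?_⟩, fun v w hvw => ?_⟩, Y, hY.twist φ⟩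
  · have h1 : autImage φ (autImage φ⁻¹ H) = H := by
      rw [← autImage_mul, mul_inv_cancel, autImage_one]
    rw [← h1, isElliptic_twist, isElliptic_autImage hT hcomm, hS.1.2]
  · exact (congrArg (· ∈ 𝓐) (edgeStab_twist S φ v w)).mpr ((hφ _).2 (hS.2 v w hvw))

theorem isLeast_autImage {T : GTree G} (hT : T.IsGBSTree)
    (hcomm : ∀ a, IsCommensuratedElement a → ¬ T.IsLoxodromic a) {𝓐 : Set (Subgroup G)}
    {h : G} {A : Subgroup G} (hA : IsLeast {B : Subgroup G | T.IsSpecialFactor 𝓐 B ∧ h ∈ B} A)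
    {φ : MulAut G} (hφ : φ ∈ autStabilizer 𝓐) :
    IsLeast {B : Subgroup G | T.IsSpecialFactor 𝓐 B ∧ φ h ∈ B} (autImage φ A) := by
  refine ⟨⟨hA.1.1.map hT hcomm hφ, apply_mem_autImage.2 hA.1.2⟩, ?_⟩
  rintro B ⟨hB, hhB⟩ g hg
  have h1 : A ≤ autImage φ⁻¹ B :=
    hA.2 ⟨hB.map hT hcomm (inv_mem hφ), by rwa [mem_autImage, inv_inv]⟩
  have h2 := h1 (mem_autImage.1 hg)
  rwa [apply_mem_autImage] at h2

/-- Two loxodromic elements which agree at `v`, as do their inverses, lie in the same special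
factors. -/
theorem IsSpecialFactor.mem_of_smul_eq {T S : GTree G} (hS : S ∈ T.deformationSpace)
    {𝓐 : Set (Subgroup G)} {B : Subgroup G} (hB : T.IsSpecialFactor 𝓐 B) {x y : G}
    (hlox : T.IsLoxodromic x) {v : S.V} (h1 : y • v = x • v) (h2 : y⁻¹ • v = x⁻¹ • v)
    (hx : x ∈ B) : y ∈ B := by
  -- The element `y * x⁻¹` fixes both `v` and `x • v`, hence the path between them, which meets a
  -- block for `B`.
  have hmem : y * x⁻¹ ∈ S.vertexStab v ⊓ autImage (MulAut.conj x) (S.vertexStab v) := by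
    rw [← vertexStab_smul]
    refine Subgroup.mem_inf.2 ⟨?_, ?_⟩
    · rw [mem_vertexStab, mul_smul, ← h2, smul_inv_smul]
    · rw [mem_vertexStab, mul_smul, inv_smul_smul, h1]
  have := B.mul_mem (hB.inf_conj_le hx hlox ((hS.2 _).1 (S.isElliptic_vertexStab v)) hmem) hx
  simpa using this

/-! ### Translation lengths and outer classes -/

namespace EdgeLength

theorem exists_pos_le {S : GTree G} (hS : S.IsCocompact) (ℓ : S.EdgeLength) :
    ∃ ε : ℝ, 0 < ε ∧ ∀ v w, S.graph.Adj v w → ε ≤ ℓ.len v w := by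
  obtain ⟨-, s, hs, hcov⟩ := hS
  have key : ∃ ε : ℝ, 0 < ε ∧ ∀ e ∈ s, S.graph.Adj e.1 e.2 → ε ≤ ℓ.len e.1 e.2 := by
    -- The inserted `1` keeps the set nonempty when there are no edges.
    have hfin : (insert 1 ((fun e : S.V × S.V => ℓ.len e.1 e.2) ''
        {e ∈ s | S.graph.Adj e.1 e.2})).Finite :=
      ((hs.subset (Set.sep_subset _ _)).image _).insert 1
    obtain ⟨ε, hε, hmin⟩ := Set.exists_min_image _ id hfin ⟨1, Set.mem_insert _ _⟩
    refine ⟨ε, ?_, fun e he hadj => hmin _ (Or.inr ⟨e, ⟨he, hadj⟩, rfl⟩)⟩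
    rcases hε with rfl | ⟨e, ⟨-, hadj⟩, rfl⟩
    · exact one_pos
    · exact ℓ.pos _ _ hadj
  obtain ⟨ε, hε, h⟩ := key
  refine ⟨ε, hε, fun v w hvw => ?_⟩
  obtain ⟨g, hg⟩ := hcov v w hvw
  rw [← ℓ.smul g]
  exact h _ hg (S.adj_smul g v w hvw)

theorem mul_length_le {S : GTree G} (ℓ : S.EdgeLength) {ε : ℝ}
    (hε : ∀ v w, S.graph.Adj v w → ε ≤ ℓ.len v w) {v w : S.V} (p : S.graph.Walk v w) :
    p.length * ε ≤ (p.darts.map fun d => ℓ.len d.fst d.snd).sum := by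
  induction p with
  | nil => simp
  | @cons a b c hab p ih =>
    rw [Walk.darts_cons, List.map_cons, List.sum_cons, Walk.length_cons]
    have := hε a b hab
    push_cast
    linarith

/-- A bound on the translation length bounds the displacement of some vertex. -/
theorem exists_dist_le {S : GTree G} (hS : S.IsCocompact) (ℓ : S.EdgeLength) (C : ℝ) :
    ∃ N : ℕ, ∀ g : G, ℓ.translationLength g ≤ C → ∃ v : S.V, S.graph.dist v (g • v) ≤ N := by
  obtain ⟨ε, hε, hle⟩ := ℓ.exists_pos_le hS
  have hne := S.isTree.connected.nonempty
  -- The extra `1` gives a strict inequality, so that a vertex and a walk nearly realizing the two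
  -- infima can be chosen.
  refine ⟨⌈(C + 1) / ε⌉₊, fun g hg => ?_⟩
  obtain ⟨v, hv⟩ := exists_lt_of_ciInf_lt (lt_of_le_of_lt hg (lt_add_one C))
  have hwalk : Nonempty (S.graph.Walk v (g • v)) := S.isTree.connected.preconnected v (g • v)
  obtain ⟨p, hp⟩ := exists_lt_of_ciInf_lt hv
  refine ⟨v, (SimpleGraph.dist_le p).trans ?_⟩
  have h1 := (ℓ.mul_length_le hle p).trans hp.le
  exact_mod_cast ((le_div_iff₀ hε).2 h1).trans (Nat.le_ceil _)

end EdgeLength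

theorem outClass_mul (φ ψ : MulAut G) : outClass (φ * ψ) = outClass φ * outClass ψ := rfl

theorem outClass_inv (φ : MulAut G) : outClass φ⁻¹ = (outClass φ)⁻¹ := rfl

theorem outClass_pow (φ : MulAut G) (n : ℕ) : outClass (φ ^ n) = outClass φ ^ n := rfl

theorem outClass_conj_mul (k : G) (φ : MulAut G) :
    outClass (MulAut.conj k * φ) = outClass φ := by
  have h : outClass (MulAut.conj k) = 1 :=
    (QuotientGroup.eq_one_iff (N := (MulAut.conj (G := G)).range) _).2 ⟨k, rfl⟩
  rw [outClass_mul, h, one_mul]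

/-- One representative suffices, since any other differs from it by an inner automorphism. -/
theorem fixesConjClass_of_autImage_eq {Φ : OutAut G} {A : Subgroup G} {ψ : MulAut G}
    (hψ : outClass ψ = Φ) (hA : autImage ψ A = A) : FixesConjClass Φ A := by
  intro θ hθ
  have h1 : outClass (θ * ψ⁻¹) = 1 := by
    rw [outClass_mul, outClass_inv, hθ, hψ, mul_inv_cancel]
  obtain ⟨g, hg⟩ := (QuotientGroup.eq_one_iff (N := (MulAut.conj (G := G)).range) _).1 h1
  refine ⟨g, ?_⟩
  rw [hg, autImage_mul]
  conv_rhs => rw [← hA, ← autImage_mul ψ⁻¹, inv_mul_cancel, autImage_one]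

end GTree

/-! ### The pigeonhole argument -/

open GTree

theorem mainTheorem1 {G : Type u} [Group G] (T : GTree G) (hT : T.IsGBSTree)
    (Φ : OutAut G) (𝓐 : Set (Subgroup G)) (h𝓐 : IsEdgeFamily Φ 𝓐)
    (h : G) (hsimple : T.IsSimpleElement 𝓐 h) (hper : T.IsPseudoPeriodic Φ h) :
    (∃ m : ℕ, 1 ≤ m ∧ T.IsReducible 𝓐 (Φ ^ m)) ∧
    ∃ A : Subgroup G, IsLeast {B : Subgroup G | T.IsSpecialFactor 𝓐 B ∧ h ∈ B} A ∧
      A ≠ ⊤ ∧ IsPeriodicConjClass Φ A := by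
  have hcomm : ∀ a, IsCommensuratedElement a → ¬ T.IsLoxodromic a :=
    fun a => hsimple.not_isLoxodromic
  obtain ⟨hlox, B, hB, hBtop, hhB⟩ := hsimple
  obtain ⟨A, hA⟩ := exists_isLeast_specialFactor hT h𝓐.subgroup hlox ⟨B, hB, hhB⟩
  have hAtop : A ≠ ⊤ := fun h => hBtop (top_le_iff.1 (h ▸ hA.2 ⟨hB, hhB⟩))
  suffices hfix : ∃ m : ℕ, 1 ≤ m ∧ FixesConjClass (Φ ^ m) A by
    obtain ⟨m, hm, hf⟩ := hfix
    exact ⟨⟨m, hm, A, hA.1.1, hAtop, hf⟩, A, hA, hAtop, m, hm, hf⟩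
  obtain ⟨S, hS, ℓ, φ, hφ, C, hC⟩ := hper
  obtain ⟨N, hN⟩ := ℓ.exists_dist_le hS.1.cocompact C
  obtain ⟨⟨s, hs, hcov⟩, -⟩ := hS.1.cocompact
  have hex : ∀ n : ℕ, ∃ v ∈ s, ∃ k : G,
      S.graph.dist v ((MulAut.conj k * φ ^ n) h • v) ≤ N := by
    intro n
    obtain ⟨w, hw⟩ := hN _ (hC n)
    obtain ⟨k, hk⟩ := hcov w
    refine ⟨k • w, hk, k, ?_⟩
    have : (MulAut.conj k * φ ^ n) h • k • w = k • (φ ^ n) h • w := by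
      rw [MulAut.mul_apply, MulAut.conj_apply, mul_smul, mul_smul, inv_smul_smul]
    rw [this, S.dist_smul]
    exact hw
  choose v hv k hk using hex
  set ψ : ℕ → MulAut G := fun n => MulAut.conj (k n) * φ ^ n with hψ
  have hψmem : ∀ n, ψ n ∈ autStabilizer 𝓐 := fun n =>
    mul_mem (h𝓐.conj_mem_autStabilizer _) (pow_mem (h𝓐.mem_autStabilizer hφ) n)
  have hψout : ∀ n, outClass (ψ n) = Φ ^ n := fun n => by
    rw [hψ, outClass_conj_mul, outClass_pow, hφ]
  have hψlox : ∀ n, T.IsLoxodromic (ψ n h) := fun n => isLoxodromic_map hT hcomm hlox _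
  have hball : (⋃ w ∈ s, {z | S.graph.dist w z ≤ N}).Finite :=
    hs.biUnion fun w _ => hS.1.ball_finite w N
  -- After conjugation the displaced vertex lies in a finite set, and balls are finite, so only
  -- finitely many triples occur. The inverse is recorded because `mem_of_smul_eq` needs it.
  have hmaps : ∀ n, (v n, ψ n h • v n, (ψ n h)⁻¹ • v n) ∈
      s ×ˢ (⋃ w ∈ s, {z | S.graph.dist w z ≤ N}) ×ˢ (⋃ w ∈ s, {z | S.graph.dist w z ≤ N}) := by
    refine fun n => ⟨hv n, Set.mem_biUnion (hv n) (hk n), Set.mem_biUnion (hv n) ?_⟩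
    change S.graph.dist (v n) ((ψ n h)⁻¹ • v n) ≤ N
    rw [← S.dist_smul (ψ n h), smul_inv_smul, SimpleGraph.dist_comm]
    exact hk n
  obtain ⟨n, m, hnm, heq⟩ := (hs.prod (hball.prod hball)).exists_lt_map_eq_of_forall_mem hmaps
  rw [Prod.mk.injEq, Prod.mk.injEq] at heq
  obtain ⟨hvv, h1, h2⟩ := heq
  rw [← hvv] at h1 h2
  have hsets : {B : Subgroup G | T.IsSpecialFactor 𝓐 B ∧ ψ n h ∈ B} =
      {B : Subgroup G | T.IsSpecialFactor 𝓐 B ∧ ψ m h ∈ B} := by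
    ext E
    exact ⟨fun ⟨hE, hx⟩ => ⟨hE, hE.mem_of_smul_eq hS (hψlox n) h1.symm h2.symm hx⟩,
      fun ⟨hE, hx⟩ => ⟨hE, hE.mem_of_smul_eq hS (hψlox m) h1 h2 hx⟩⟩
  have hAn := isLeast_autImage hT hcomm hA (hψmem n)
  rw [hsets] at hAn
  have hAA := hAn.unique (isLeast_autImage hT hcomm hA (hψmem m))
  refine ⟨m - n, by omega, fixesConjClass_of_autImage_eq (ψ := (ψ n)⁻¹ * ψ m) ?_ ?_⟩
  · rw [outClass_mul, outClass_inv, hψout, hψout,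
      inv_mul_eq_iff_eq_mul, ← pow_add, Nat.add_sub_cancel' hnm.le]
  · rw [autImage_mul, ← hAA, ← autImage_mul, inv_mul_cancel, autImage_one]
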